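/- Let $\mathbb F_2$ be the free group with free generators $a,b$, let $\delta_x$ ($x\in\mathbb F_2$) be the standard orthonormal basis of $\ell^2\mathbb F_2$, and let $\lambda$ be the left regular representation, $\lambda_g\delta_x=\delta_{gx}$. Let $|x|$ be the word length of $x$ with respect to $a^{\pm1},b^{\pm1}$, let $\alpha$ be the automorphism of $\mathbb F_2$ that interchanges $a$ and $b$, and let $U$ be the unitary $U\delta_x=\delta_{\alpha(x)}$. Let $V$ be the unitary on $\ell^2\mathbb F_2$ that is the identity on $\ker(U-1)$ and multiplication by $i$ on $\ker(U+1)$. For integers $N\ge1$ and $R\ge0$ let $F_{N,R}$ be the set of pairs $(k,x)$ with $0\le k\le N-1$, $|x|\le R$, and $x=e$ or the reduced word of $x$ beginning with $b$ or $b^{-1}$. Let $P_{N,R}$ be the orthogonal projection onto the span of the vectors $$\sqrt{\tfrac kN}\,\delta_{a^{k-N}x}+\sqrt{\tfrac{N-k}N}\,\delta_{a^kx},\qquad (k,x)\in F_{N,R},$$ and let $Q_{N,R}=VP_{N,R}V^*$, with $Q_{N,R}=0$ for $N=0$. Then: 1. Each $Q_{N,R}$ is a finite rank projection, and there is $N_0$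 such that for all integers $N\ge N_0$ and $R\ge1$ with $R\,4^R\le N^{1/4}$, $$\max\{\|[\lambda_a,Q_{N,R}]\|,\|[\lambda_b,Q_{N,R}]\|\}\le\frac{\sqrt3}2+N^{-1/9}.$$ 2. If $R(N)\to\infty$ as $N\to\infty$, then $Q_{N,R(N)}\to1$ in the strong operator topology. 3. $\mathrm{qd}(\{\lambda_a,\lambda_b\})\in[\tfrac12,\tfrac{\sqrt3}2]$, where for a finite nonempty set $\Omega$ of bounded operators on a Hilbert space $\mathrm{qd}(\Omega)=\liminf_P\max_{T\in\Omega}\|TP-PT\|$, the $\liminf$ being taken over the directed set of finite rank orthogonal projections $P$ with the usual order of self-adjoint operators. -/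

import Mathlib

namespace FreeQD

noncomputable section

open Filter Topology
open scoped ENNReal

/-! ### The modulus of quasidiagonality -/

section Modulus

variable {H : Type*} [NormedAddCommGroup H] [InnerProductSpace ℂ H] [CompleteSpace H]

/-- A finite rank (orthogonal) projection in `B(H)`. -/
def IsFiniteRankProjection (P : H →L[ℂ] H) : Prop :=
  IsStarProjection P ∧ FiniteDimensional ℂ (P : H →ₗ[ℂ] H).range

variable (H) in
/-- The set `P(H)` of finite rank projections in `B(H)`, with the usual (Loewner) order of
operators inherited from `H →L[ℂ] H`. -/
abbrev FiniteRankProjection : Type _ := {P : H →L[ℂ] H // IsFiniteRankProjection P}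

/-- The commutator `[T, S] = T S - S T`. -/
def comm (T S : H →L[ℂ] H) : H →L[ℂ] H := T * S - S * T

/-- The modulus of quasidiagonality of a (finite, nonempty) set of operators `Ω`:
`liminf` over the directed set of finite rank projections `P` of `max_{T ∈ Ω} ‖[T, P]‖`. -/
def qd (Ω : Set (H →L[ℂ] H)) : ℝ :=
  liminf (fun P : FiniteRankProjection H => ⨆ T : Ω, ‖comm (T : H →L[ℂ] H) P.1‖) atTop

end Modulus

/-! ### Operators on `ℓ²(G)` that permute the standard basis -/

/-- The Hilbert space `ℓ²(G)`. -/
abbrev ell2 (G : Type*) : Type _ := lp (fun _ : G => ℂ) 2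

section Perm

variable {G : Type*}

/-- The standard basis vector `δ_x` of `ℓ²(G)`. -/
def delta (x : G) : ell2 G := by
  classical exact lp.single 2 x (1 : ℂ)

theorem memlp_perm (σ : G ≃ G) (f : ell2 G) :
    Memℓp (fun x => f (σ.symm x)) 2 := by
  have h := lp.memℓp f
  rw [memℓp_gen_iff (by norm_num)] at h ⊢
  exact (σ.symm.summable_iff (f := fun x => ‖f x‖ ^ (2 : ℝ≥0∞).toReal)).2 h

/-- The unitary of `ℓ²(G)` given by `(U_σ f)(x) = f (σ⁻¹ x)`, that is `U_σ δ_x = δ_{σ x}`,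
for a permutation `σ` of `G`. -/
def permOp (σ : G ≃ G) : ell2 G →L[ℂ] ell2 G :=
  LinearIsometry.toContinuousLinearMap
    { toFun := fun f => ⟨fun x => f (σ.symm x), memlp_perm σ f⟩
      map_add' := fun _ _ => rfl
      map_smul' := fun _ _ => rfl
      norm_map' := fun f => by
        rw [lp.norm_eq_tsum_rpow (by norm_num), lp.norm_eq_tsum_rpow (by norm_num)]
        congr 1
        exact σ.symm.tsum_eq (fun x => ‖f x‖ ^ (2 : ℝ≥0∞).toReal) }

theorem permOp_apply (σ : G ≃ G) (f : ell2 G) (x : G) : permOp σ f x = f (σ.symm x) := rfl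

theorem permOp_delta (σ : G ≃ G) (x : G) : permOp σ (delta x) = delta (σ x) := by
  classical
  ext y
  rw [permOp_apply]
  simp only [delta, lp.single_apply, Pi.single_apply, Equiv.symm_apply_eq]

/-- The left regular representation: `λ_g δ_x = δ_{g x}`. -/
def leftRegular [Group G] (g : G) : ell2 G →L[ℂ] ell2 G := permOp (Equiv.mulLeft g)

theorem leftRegular_delta [Group G] (g x : G) :
    leftRegular g (delta x) = delta (g * x) := permOp_delta _ _

end Perm

/-! ### The twisted projections

Here `G` is a group with a free basis `B` indexed by `Fin 2`, that is, a free group of rank two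
with free generators `a = B 0` and `b = B 1`. -/

section Twisted

variable {G : Type*} [Group G] (B : FreeGroupBasis (Fin 2) G)

/-- The reduced word of `x` in the letters `a, a⁻¹, b, b⁻¹`. -/
def word (x : G) : List (Fin 2 × Bool) := (B.repr x).toWord

/-- The word length of `x` with respect to `a, b, a⁻¹, b⁻¹`. -/
def len (x : G) : ℕ := (word B x).length

/-- The set `W_x` of elements whose reduced word begins with the reduced word of `x`
(used for `x ≠ e` only). -/
def W (x : G) : Set G := {y | word B x <+: word B y}

/-- The automorphism of the free group that interchanges `a` and `b`. -/
def swapAut : G ≃* G :=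
  (B.repr.trans (FreeGroup.freeGroupCongr (Equiv.swap (0 : Fin 2) 1))).trans B.repr.symm

theorem swapAut_zero : swapAut B (B 0) = B 1 := by
  simp [swapAut, FreeGroupBasis.repr_apply_coe, MulEquiv.symm_apply_eq]

theorem swapAut_one : swapAut B (B 1) = B 0 := by
  simp [swapAut, FreeGroupBasis.repr_apply_coe, MulEquiv.symm_apply_eq]

theorem swapAut_swapAut (x : G) : swapAut B (swapAut B x) = x := by
  have h : (swapAut B).toMonoidHom.comp (swapAut B).toMonoidHom = MonoidHom.id G := by
    refine B.ext_hom _ _ fun i => ?_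
    fin_cases i
    · exact (congrArg (swapAut B) (swapAut_zero B)).trans (swapAut_one B)
    · exact (congrArg (swapAut B) (swapAut_one B)).trans (swapAut_zero B)
  exact DFunLike.congr_fun h x

/-- The self-adjoint unitary `U δ_x = δ_{α(x)}`, where `α` interchanges `a` and `b`. -/
def U : ell2 G →L[ℂ] ell2 G := permOp (swapAut B).toEquiv

/-- The unitary that is the identity on the eigenspace `E₁` of `U` and multiplication by `i` on
the eigenspace `E₋₁`. As `U² = 1`, the projections onto these eigenspaces are `(1 + U) / 2` and
`(1 - U) / 2`. -/
def V : ell2 G →L[ℂ] ell2 G :=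
  (1 / 2 : ℂ) • (1 + U B) + (Complex.I / 2) • (1 - U B)

theorem U_mul_U : U B * U B = 1 := by
  ext f x
  exact congrArg f ((swapAut B).symm_apply_eq.2 ((swapAut B).symm_apply_eq.2
    (swapAut_swapAut B x).symm))

theorem V_apply_of_eigen_one {f : ell2 G} (hf : U B f = f) : V B f = f := by
  simp only [V, add_apply, smul_apply, one_apply_eq_self,
    sub_apply, hf, sub_self, smul_zero, add_zero, ← two_smul ℂ f, smul_smul]
  norm_num

theorem V_apply_of_eigen_neg_one {f : ell2 G} (hf : U B f = -f) : V B f = Complex.I • f := by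
  simp only [V, add_apply, smul_apply, one_apply_eq_self,
    sub_apply, hf, add_neg_cancel, smul_zero, zero_add, sub_neg_eq_add,
    ← two_smul ℂ f, smul_smul]
  norm_num

/-- The index set `F = {(k, x) : 0 ≤ k ≤ N - 1, |x| ≤ R, x ∈ W_b ∪ W_{b⁻¹} ∪ {e}}`. -/
def F (N R : ℕ) : Set (ℕ × G) :=
  {p | p.1 < N ∧ len B p.2 ≤ R ∧ p.2 ∈ W B (B 1) ∪ W B (B 1)⁻¹ ∪ {1}}

/-- The vector `√(k/N) δ_{a^{k-N} x} + √((N-k)/N) δ_{a^k x}`. -/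
def etaPrime (N k : ℕ) (x : G) : ell2 G :=
  (Real.sqrt ((k : ℝ) / N) : ℂ) • delta (B 0 ^ ((k : ℤ) - (N : ℤ)) * x) +
    (Real.sqrt (((N : ℝ) - k) / N) : ℂ) • delta (B 0 ^ (k : ℤ) * x)

theorem F_finite (N R : ℕ) : (F B N R).Finite := by
  have hinj : Function.Injective (word B) :=
    FreeGroup.toWord_injective.comp B.repr.injective
  have hball : {x : G | len B x ≤ R}.Finite :=
    Set.Finite.preimage hinj.injOn (List.finite_length_le (Fin 2 × Bool) R)
  exact ((Set.finite_lt_nat N).prod hball).subset fun p hp => ⟨hp.1, hp.2.1⟩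

/-- The span of the vectors `η'(k, x)` with `(k, x) ∈ F`. -/
def etaSpan (N R : ℕ) : Submodule ℂ (ell2 G) :=
  Submodule.span ℂ ((fun p : ℕ × G => etaPrime B N p.1 p.2) '' F B N R)

instance etaSpan_finiteDimensional (N R : ℕ) : FiniteDimensional ℂ (etaSpan B N R) :=
  FiniteDimensional.span_of_finite ℂ ((F_finite B N R).image _)

/-- The orthogonal projection `P` onto the span of the vectors `η'(k, x)`, `(k, x) ∈ F`. -/
def P (N R : ℕ) : ell2 G →L[ℂ] ell2 G := (etaSpan B N R).starProjection

/-- The twisted projection `Q = V P V*`. -/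
def Q (N R : ℕ) : ell2 G →L[ℂ] ell2 G := V B * P B N R * star (V B)

end Twisted

end

end FreeQD

/-!
**The commutators with `Q`.** Every element of the free group is uniquely `a^j x` with `x` in
`base B`, that is, with the reduced word of `x` not beginning with a power of `a`. On the coset
`⟨a⟩ x` the vectors `η'(k, x)` interpolate between `δ_{a^k x}` and `δ_{a^{k-N} x}`, so that the
range of `P` is invariant under `λ_a` up to `√(2/N)` (Berg's technique,
`norm_starProjection_orthogonal_leftRegular_le`) and contains every function supported in the ball
of radius `R` up to `√(2R/N)` (`norm_starProjection_orthogonal_ball_le`). In both cases the errors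
of different basis vectors are orthogonal, so that they do not add up.

Conjugation by `V` turns the commutator of `λ_a` with `Q` into that of
`T = ½ (λ_a + λ_b) - (i/2) (λ_a - λ_b) U` with `P`, and for a projection and an operator only the
corners `P⊥ T P` and `P⊥ T* P` matter (`norm_comm_starProjection_le`). For `ξ` in the range of `P`,
the vector `T ξ` is, up to parts that are almost in the range of `P`, the sum of
`½ λ_b (1 + i U) ξ` restricted to `base B` and of `-(i/2) λ_a U ξ` restricted to the complement. As
`U` is a self-adjoint unitary, `1 + i U` is `√2` times a unitary, so that these orthogonal vectors
have norms at most `√2/2` and `1/2`, which gives `√3/2`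
(`norm_starProjection_orthogonal_twist_le`). The same applies to `λ_b` and to the adjoints, with
other signs.

**Upper bound for the modulus.** The `Q` converge strongly to the identity, and almost dominate any
given finite rank projection. A small perturbation in norm then dominates it
(`exists_starProjection_near`), which makes the commutator estimate available cofinally
(`qd_pair_le_of_tendsto`).

**Lower bound for the modulus.** If `P` is a nonzero projection of rank `n`, then
`S ↦ tr (P 1_S) / n` is a finitely additive probability on the group that changes under translation
by `g` by at most `‖[λ_g, P]‖` (`sum_norm_sq_restr_sub_le`). The paradoxical decomposition into the
sets of words beginning with `a`, `a⁻¹`, `b`, `b⁻¹` forces one of the two commutators to have norm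
at least `1/2` (`half_le_max_norm_comm`).
-/

namespace FreeQD

noncomputable section

open Filter Topology
open scoped ENNReal

/-! ### Reduced words -/

section Words

variable {G : Type*} [Group G] (B : FreeGroupBasis (Fin 2) G)

/-- The element of `G` given by a single letter, `(i, true)` standing for the `i`-th generator and
`(i, false)` for its inverse. -/
def letter (l : Fin 2 × Bool) : G := cond l.2 (B l.1) (B l.1)⁻¹

theorem repr_letter (l : Fin 2 × Bool) : B.repr (letter B l) = FreeGroup.mk [l] := by
  rcases l with ⟨i, _ | _⟩
  · simp only [letter, cond_false, map_inv, FreeGroupBasis.repr_apply_coe]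
    rfl
  · simp only [letter, cond_true, FreeGroupBasis.repr_apply_coe]
    rfl

theorem word_injective : Function.Injective (word B) :=
  FreeGroup.toWord_injective.comp B.repr.injective

theorem word_one : word B 1 = [] := by simp [word]

theorem word_letter (l : Fin 2 × Bool) : word B (letter B l) = [l] := by
  rw [word, repr_letter, FreeGroup.toWord_mk, FreeGroup.reduce_singleton]

theorem word_letter_mul_eq_reduce (l : Fin 2 × Bool) (y : G) :
    word B (letter B l * y) = FreeGroup.reduce (l :: word B y) := by
  rw [word, map_mul, FreeGroup.toWord_mul, repr_letter, FreeGroup.toWord_mk,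
    FreeGroup.reduce_singleton]
  rfl

/-- Left multiplication by a letter that is not cancelled prepends this letter. -/
theorem word_letter_mul (l : Fin 2 × Bool) (y : G) (h : (l.1, !l.2) ∉ (word B y).head?) :
    word B (letter B l * y) = l :: word B y := by
  have hr : FreeGroup.reduce (word B y) = word B y := FreeGroup.reduce_toWord _
  rw [word_letter_mul_eq_reduce, FreeGroup.reduce.cons, hr]
  cases hw : word B y with
  | nil => rfl
  | cons m t =>
    rw [hw] at h
    refine if_neg fun hm => h ?_
    simp only [List.head?_cons, Option.mem_def, Option.some.injEq]
    exact Prod.ext hm.1.symm (by simp [hm.2])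

theorem letter_inv (l : Fin 2 × Bool) : (letter B l)⁻¹ = letter B (l.1, !l.2) := by
  rcases l with ⟨i, _ | _⟩ <;> simp [letter]

/-- If the reduced word of `y` is `l :: t`, then `y` is the product of `l` with the element whose
reduced word is `t`. -/
theorem exists_eq_letter_mul {y : G} {l : Fin 2 × Bool} {t : List (Fin 2 × Bool)}
    (h : word B y = l :: t) : ∃ y', y = letter B l * y' ∧ word B y' = t := by
  refine ⟨(letter B l)⁻¹ * y, by group, ?_⟩
  have hr : FreeGroup.reduce (l :: t) = l :: t := by
    rw [← h]; exact FreeGroup.reduce_toWord _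
  rw [letter_inv, word_letter_mul_eq_reduce, FreeGroup.reduce.cons, h, hr]
  simp

/-- The elements whose reduced word does not begin with a power of `a = B 0`: representatives of
the right cosets of the subgroup generated by `a`. -/
def base : Set G := W B (B 1) ∪ W B (B 1)⁻¹ ∪ {1}

theorem mem_W_letter {l : Fin 2 × Bool} {y : G} : y ∈ W B (letter B l) ↔ l ∈ (word B y).head? := by
  rw [W, Set.mem_ofPred_eq, word_letter]
  cases word B y <;> simp [eq_comm]

theorem coe_eq_letter (i : Fin 2) : B i = letter B (i, true) := rfl

theorem inv_coe_eq_letter (i : Fin 2) : (B i)⁻¹ = letter B (i, false) := rfl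

theorem mem_base {y : G} : y ∈ base B ↔ ∀ l ∈ (word B y).head?, l.1 = 1 := by
  have h1 : y = 1 ↔ word B y = [] := by rw [← word_one B, (word_injective B).eq_iff]
  simp only [base, Set.mem_union, Set.mem_singleton_iff, h1]
  rw [inv_coe_eq_letter, coe_eq_letter, mem_W_letter, mem_W_letter]
  cases word B y with
  | nil => simp
  | cons m t => rcases m with ⟨i, _ | _⟩ <;> simp

theorem word_pow_mul {x : G} (s : Bool) (hx : x ∈ base B) (n : ℕ) :
    word B (letter B (0, s) ^ n * x) = List.replicate n (0, s) ++ word B x := by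
  induction n with
  | zero => simp
  | succ n ih =>
    rw [pow_succ', mul_assoc, word_letter_mul, ih, List.replicate_succ, List.cons_append]
    rw [ih]
    cases n with
    | zero =>
      intro h
      simpa using mem_base B |>.1 hx _ h
    | succ n => simp [List.replicate_succ]

theorem zpow_eq_letter_pow (j : ℤ) : B 0 ^ j = letter B (0, decide (0 ≤ j)) ^ j.natAbs := by
  obtain ⟨n, rfl | rfl⟩ := j.eq_nat_or_neg
  · simp [letter]
  · rcases Nat.eq_zero_or_pos n with rfl | hn
    · simp
    · simp [letter, hn.ne']

/-- The reduced word of `a^j x`, for a coset representative `x`. -/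
theorem word_zpow_mul {x : G} (hx : x ∈ base B) (j : ℤ) :
    word B (B 0 ^ j * x) = List.replicate j.natAbs (0, decide (0 ≤ j)) ++ word B x := by
  rw [zpow_eq_letter_pow, word_pow_mul B _ hx]

theorem len_zpow_mul {x : G} (hx : x ∈ base B) (j : ℤ) :
    len B (B 0 ^ j * x) = j.natAbs + len B x := by
  simp [len, word_zpow_mul B hx]

theorem zpow_mul_mem_base_iff {x : G} (hx : x ∈ base B) {j : ℤ} :
    B 0 ^ j * x ∈ base B ↔ j = 0 := by
  constructor
  · intro h
    by_contra hj
    rw [mem_base, word_zpow_mul B hx] at h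
    obtain ⟨n, hn⟩ := Nat.exists_eq_succ_of_ne_zero (Int.natAbs_ne_zero.2 hj)
    rw [hn] at h
    simp [List.replicate_succ] at h
  · rintro rfl
    simpa using hx

theorem zpow_mul_inj {x x' : G} (hx : x ∈ base B) (hx' : x' ∈ base B) {j j' : ℤ}
    (h : B 0 ^ j * x = B 0 ^ j' * x') : j = j' ∧ x = x' := by
  have h' : B 0 ^ (j - j') * x = x' := by
    rw [zpow_sub, (Commute.zpow_zpow_self (B 0) j j').inv_right.eq, mul_assoc, h]
    group
  have hj : j - j' = 0 := (zpow_mul_mem_base_iff B hx).1 (by rwa [h'])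
  rw [hj] at h'
  exact ⟨sub_eq_zero.1 hj, by simpa using h'⟩

/-- Every element is a power of `a` times a coset representative. -/
theorem exists_zpow_mul (w : G) : ∃ (j : ℤ) (x : G), x ∈ base B ∧ w = B 0 ^ j * x := by
  generalize ht : word B w = t
  induction t generalizing w with
  | nil => exact ⟨0, w, by simp [mem_base, ht], by simp⟩
  | cons l t ih =>
    rcases l with ⟨i, s⟩
    by_cases hi : i = 1
    · exact ⟨0, w, by simp [mem_base, ht, hi], by simp⟩
    · obtain rfl : i = 0 := by omega
      obtain ⟨y, rfl, hy⟩ := exists_eq_letter_mul B ht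
      obtain ⟨j, x, hx, rfl⟩ := ih y hy
      cases s
      · exact ⟨-1 + j, x, hx, by simp [letter, zpow_add, mul_assoc]⟩
      · exact ⟨1 + j, x, hx, by simp [letter, zpow_add, mul_assoc]⟩

theorem word_swapAut (y : G) :
    word B (swapAut B y) = (word B y).map fun l => (Equiv.swap 0 1 l.1, l.2) := by
  have h1 : B.repr (swapAut B y) = FreeGroup.map (Equiv.swap (0 : Fin 2) 1) (B.repr y) := by
    simp only [swapAut, MulEquiv.trans_apply, MulEquiv.apply_symm_apply]
    rfl
  have h2 : B.repr y = FreeGroup.mk (word B y) := FreeGroup.mk_toWord.symm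
  have h3 : FreeGroup.IsReduced (word B y) := FreeGroup.isReduced_toWord
  rw [word, h1, h2, FreeGroup.map.mk, FreeGroup.toWord_mk, FreeGroup.IsReduced.reduce_eq]
  rw [FreeGroup.IsReduced, List.isChain_map]
  simpa [FreeGroup.IsReduced] using h3

theorem len_swapAut (y : G) : len B (swapAut B y) = len B y := by
  simp [len, word_swapAut]

theorem swapAut_mem_base {y : G} : swapAut B y ∈ base B ↔ ∀ l ∈ (word B y).head?, l.1 = 0 := by
  rw [mem_base, word_swapAut, List.head?_map]
  cases word B y with
  | nil => simp
  | cons m t => simp [Equiv.swap_apply_eq_iff]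

theorem swapAut_mem_base_of_notMem {y : G} (hy : y ∉ base B) : swapAut B y ∈ base B := by
  rw [swapAut_mem_base]
  rw [mem_base] at hy
  cases h : word B y with
  | nil => simp [h] at hy
  | cons m t =>
    simp only [h, List.head?_cons, Option.mem_def, Option.some.injEq, forall_eq'] at hy ⊢
    omega

/-- If the reduced word of `y` does not begin with a power of `b`, then multiplication by `b` or
`b⁻¹` increases the length and leads to `base B`. -/
theorem zpow_one_mul_mem_base {y : G} (hy : swapAut B y ∈ base B) {ε : ℤ} (hε : ε = 1 ∨ ε = -1) :
    B 1 ^ ε * y ∈ base B ∧ len B (B 1 ^ ε * y) = len B y + 1 := by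
  have key : ∀ s : Bool, word B (letter B (1, s) * y) = (1, s) :: word B y := fun s =>
    word_letter_mul B _ _ fun h => by simpa using (swapAut_mem_base B).1 hy _ h
  obtain ⟨s, hs⟩ : ∃ s, B 1 ^ ε = letter B (1, s) := by
    rcases hε with rfl | rfl
    · exact ⟨true, by simp [letter]⟩
    · exact ⟨false, by simp [letter]⟩
  rw [hs]
  exact ⟨by simp [mem_base, key s], by simp [len, key s]⟩

theorem swapAut_zpow_mul_zero (ε : ℤ) (y : G) :
    swapAut B (B 0 ^ ε * y) = B 1 ^ ε * swapAut B y := by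
  rw [map_mul, map_zpow, swapAut_zero]

theorem swapAut_zpow_mul_one (ε : ℤ) (y : G) :
    swapAut B (B 1 ^ ε * y) = B 0 ^ ε * swapAut B y := by
  rw [map_mul, map_zpow, swapAut_one]

end Words

/-! ### Orthogonal expansions -/

section Hilbert

variable {H : Type*} [NormedAddCommGroup H] [InnerProductSpace ℂ H]

theorem norm_sum_smul_sq {ι : Type*} (s : Finset ι) (d : ι → H) (c : ι → ℂ)
    (hd : ∀ i ∈ s, ∀ j ∈ s, i ≠ j → inner ℂ (d i) (d j) = 0) :
    ‖∑ i ∈ s, c i • d i‖ ^ 2 = ∑ i ∈ s, ‖c i‖ ^ 2 * ‖d i‖ ^ 2 := by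
  classical
  have h : ((‖∑ i ∈ s, c i • d i‖ ^ 2 : ℝ) : ℂ) = ((∑ i ∈ s, ‖c i‖ ^ 2 * ‖d i‖ ^ 2 : ℝ) : ℂ) := by
    push_cast
    have := inner_self_eq_norm_sq_to_K (𝕜 := ℂ) (∑ i ∈ s, c i • d i)
    simp only [Complex.coe_algebraMap] at this
    rw [← this, sum_inner]
    refine Finset.sum_congr rfl fun i hi => ?_
    rw [inner_sum, Finset.sum_eq_single_of_mem i hi]
    · rw [inner_smul_left, inner_smul_right, inner_self_eq_norm_sq_to_K, ← mul_assoc,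
        Complex.conj_mul']
      simp
    · intro j hj hji
      rw [inner_smul_left, inner_smul_right, hd i hi j hj hji.symm]
      simp
  exact_mod_cast h

/-- If a linear map sends an orthonormal family into `K` up to pairwise orthogonal errors of norm
at most `δ`, then its composition with the projection onto `Kᗮ` has norm at most `δ` on the span
of the family. Here `v` is the image of `∑ c i • e i`. -/
theorem norm_starProjection_orthogonal_sum_le {ι : Type*} (K : Submodule ℂ H)
    [K.HasOrthogonalProjection] (s : Finset ι) (e y d : ι → H) (c : ι → ℂ) {δ : ℝ} (hδ : 0 ≤ δ)
    (hy : ∀ i ∈ s, y i ∈ K) (he : ∀ i ∈ s, ‖e i‖ = 1)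
    (he' : ∀ i ∈ s, ∀ j ∈ s, i ≠ j → inner ℂ (e i) (e j) = 0)
    (hd' : ∀ i ∈ s, ∀ j ∈ s, i ≠ j → inner ℂ (d i) (d j) = 0)
    (hd : ∀ i ∈ s, ‖d i‖ ^ 2 ≤ δ ^ 2) {v : H} (hv : v = ∑ i ∈ s, c i • (y i + d i)) :
    ‖Kᗮ.starProjection v‖ ≤ δ * ‖∑ i ∈ s, c i • e i‖ := by
  have h1 : Kᗮ.starProjection v = Kᗮ.starProjection (∑ i ∈ s, c i • d i) := by
    rw [hv]
    simp only [smul_add, Finset.sum_add_distrib, map_add]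
    rw [(Submodule.starProjection_apply_eq_zero_iff Kᗮ).2, zero_add]
    exact Submodule.le_orthogonal_orthogonal K
      (K.sum_mem fun i hi => K.smul_mem _ (hy i hi))
  rw [h1]
  refine (Submodule.norm_starProjection_apply_le _ _).trans ?_
  refine abs_le_of_sq_le_sq' ?_ (by positivity) |>.2
  rw [mul_pow, norm_sum_smul_sq s d c hd', norm_sum_smul_sq s e c he', Finset.mul_sum]
  refine Finset.sum_le_sum fun i hi => ?_
  rw [he i hi]
  nlinarith [hd i hi, sq_nonneg ‖c i‖]

end Hilbert

/-! ### Restriction operators on `ℓ²(G)` -/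

section Ell2

variable {G : Type*}

theorem ell2_add_apply (f g : ell2 G) (x : G) : (f + g) x = f x + g x := rfl

theorem ell2_smul_apply (c : ℂ) (f : ell2 G) (x : G) : (c • f) x = c * f x := rfl

theorem memlp_indicator (S : Set G) (f : ell2 G) : Memℓp (S.indicator f) 2 := by
  have h := lp.memℓp f
  rw [memℓp_gen_iff (by norm_num)] at h ⊢
  refine h.of_nonneg_of_le (fun x => by positivity) fun x => ?_
  exact Real.rpow_le_rpow (norm_nonneg _) (norm_indicator_le_norm_self _ _) (by norm_num)

/-- The projection of `ℓ²(G)` onto the functions supported in `S`. -/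
def restr (S : Set G) : ell2 G →L[ℂ] ell2 G :=
  LinearMap.mkContinuous
    { toFun := fun f => ⟨S.indicator f, memlp_indicator S f⟩
      map_add' := fun f g => by
        ext x
        exact congrFun (Set.indicator_add S f g) x
      map_smul' := fun c f => by
        ext x
        exact congrFun (Set.indicator_const_smul S c f) x } 1 fun f => by
    rw [one_mul, lp.norm_eq_tsum_rpow (by norm_num), lp.norm_eq_tsum_rpow (by norm_num)]
    refine Real.rpow_le_rpow (tsum_nonneg fun x => by positivity) ?_ (by norm_num)
    refine Summable.tsum_le_tsum (fun x => ?_)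
      ((memℓp_gen_iff (by norm_num)).1 (memlp_indicator S f))
      ((memℓp_gen_iff (by norm_num)).1 (lp.memℓp f))
    exact Real.rpow_le_rpow (norm_nonneg _) (norm_indicator_le_norm_self _ _) (by norm_num)

theorem restr_apply_of_mem {S : Set G} {x : G} (hx : x ∈ S) (f : ell2 G) : restr S f x = f x :=
  Set.indicator_of_mem hx f

theorem restr_apply_of_notMem {S : Set G} {x : G} (hx : x ∉ S) (f : ell2 G) : restr S f x = 0 :=
  Set.indicator_of_notMem hx f

theorem norm_restr_apply_le (S : Set G) (f : ell2 G) : ‖restr S f‖ ≤ ‖f‖ := by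
  refine ((restr S).le_of_opNorm_le (LinearMap.mkContinuous_norm_le _ zero_le_one _) f).trans ?_
  rw [one_mul]

theorem restr_add_restr_compl (S : Set G) (f : ell2 G) : restr S f + restr Sᶜ f = f := by
  ext x
  exact congrFun (Set.indicator_self_add_compl S f) x

theorem inner_eq_zero_of_disjoint {f g : ell2 G} (h : ∀ x, f x = 0 ∨ g x = 0) :
    inner ℂ f g = 0 := by
  rw [lp.inner_eq_tsum]
  refine (tsum_congr fun x => ?_).trans tsum_zero
  rcases h x with h | h <;> simp [h]

theorem norm_add_sq_of_inner_eq_zero {H : Type*} [NormedAddCommGroup H] [InnerProductSpace ℂ H]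
    {f g : H} (h : inner ℂ f g = 0) : ‖f + g‖ ^ 2 = ‖f‖ ^ 2 + ‖g‖ ^ 2 := by
  rw [sq, sq, sq]
  exact norm_add_sq_eq_norm_sq_add_norm_sq_of_inner_eq_zero _ _ h

theorem inner_restr_restr_compl (S : Set G) (f g : ell2 G) :
    inner ℂ (restr S f) (restr Sᶜ g) = 0 := by
  refine inner_eq_zero_of_disjoint fun x => ?_
  by_cases hx : x ∈ S
  · exact Or.inr (restr_apply_of_notMem (by simpa using hx) g)
  · exact Or.inl (restr_apply_of_notMem hx f)

theorem norm_sq_restr_add_restr_compl (S : Set G) (f : ell2 G) :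
    ‖restr S f‖ ^ 2 + ‖restr Sᶜ f‖ ^ 2 = ‖f‖ ^ 2 := by
  rw [← norm_add_sq_of_inner_eq_zero (inner_restr_restr_compl S f f), restr_add_restr_compl]

theorem restr_restr_compl (S : Set G) (f : ell2 G) : restr S (restr Sᶜ f) = 0 := by
  ext x
  by_cases hx : x ∈ S
  · rw [restr_apply_of_mem hx, restr_apply_of_notMem (by simpa using hx)]
    rfl
  · rw [restr_apply_of_notMem hx]
    rfl

theorem restr_restr_self (S : Set G) (f : ell2 G) : restr S (restr S f) = restr S f := by
  ext x
  by_cases hx : x ∈ S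
  · rw [restr_apply_of_mem hx]
  · rw [restr_apply_of_notMem hx, restr_apply_of_notMem hx]

theorem inner_restr_right (S : Set G) (f : ell2 G) :
    inner ℂ f (restr S f) = ((‖restr S f‖ ^ 2 : ℝ) : ℂ) := by
  conv_lhs => rw [← restr_add_restr_compl S f]
  have h : inner ℂ (restr Sᶜ f) (restr S f) = 0 := by
    rw [← inner_conj_symm, inner_restr_restr_compl, map_zero]
  rw [map_add, inner_add_left]
  rw [restr_restr_compl, restr_restr_self, add_zero, h, add_zero, inner_self_eq_norm_sq_to_K]
  simp

theorem norm_restr_sub_half_smul (S : Set G) (f : ell2 G) :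
    ‖restr S f - (1 / 2 : ℂ) • f‖ = 1 / 2 * ‖f‖ := by
  have h1 : restr S f - (1 / 2 : ℂ) • f =
      (1 / 2 : ℂ) • (restr S f + (-1 : ℂ) • restr Sᶜ f) := by
    conv_lhs => rw [← restr_add_restr_compl S f]
    rw [map_add]
    rw [restr_restr_self, restr_restr_compl]
    module
  have h4 : ‖restr S f + (-1 : ℂ) • restr Sᶜ f‖ ^ 2 = ‖f‖ ^ 2 := by
    rw [norm_add_sq_of_inner_eq_zero, ← norm_sq_restr_add_restr_compl S f, norm_smul]
    · simp
    · rw [inner_smul_right, inner_restr_restr_compl, mul_zero]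
  rw [h1, norm_smul, (sq_eq_sq₀ (norm_nonneg _) (norm_nonneg _)).1 h4]
  norm_num

theorem norm_sq_restr_union {S T : Set G} (h : Disjoint S T) (f : ell2 G) :
    ‖restr S f‖ ^ 2 + ‖restr T f‖ ^ 2 = ‖restr (S ∪ T) f‖ ^ 2 := by
  have h1 : restr (S ∪ T) f = restr S f + restr T f := by
    ext x
    exact congrFun (Set.indicator_union_of_disjoint h f) x
  rw [h1, norm_add_sq_of_inner_eq_zero]
  refine inner_eq_zero_of_disjoint fun x => ?_
  by_cases hx : x ∈ S
  · exact Or.inr (restr_apply_of_notMem (h.notMem_of_mem_left hx) f)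
  · exact Or.inl (restr_apply_of_notMem hx f)

theorem delta_apply_self (x : G) : delta x x = 1 := by
  classical simp [delta]

theorem delta_apply_of_ne {x y : G} (h : y ≠ x) : delta x y = 0 := by
  classical simp [delta, h]

theorem norm_delta (x : G) : ‖delta x‖ = 1 := by
  classical
  rw [delta, lp.norm_single (by norm_num)]
  simp

theorem inner_delta_of_ne {x y : G} (h : x ≠ y) : inner ℂ (delta x) (delta y) = 0 := by
  refine inner_eq_zero_of_disjoint fun z => ?_
  by_cases hz : z = x
  · exact Or.inr (delta_apply_of_ne (hz ▸ h))
  · exact Or.inl (delta_apply_of_ne hz)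

theorem norm_sq_smul_delta_add {x y : G} (h : x ≠ y) (α β : ℂ) :
    ‖α • delta x + β • delta y‖ ^ 2 = ‖α‖ ^ 2 + ‖β‖ ^ 2 := by
  rw [norm_add_sq_of_inner_eq_zero, norm_smul, norm_smul, norm_delta, norm_delta, mul_one, mul_one]
  rw [inner_smul_left, inner_smul_right, inner_delta_of_ne h]
  simp

theorem smul_delta_add_apply_eq_zero {x y z : G} (α β : ℂ) (hx : z ≠ x) (hy : z ≠ y) :
    (α • delta x + β • delta y) z = 0 := by
  rw [ell2_add_apply, ell2_smul_apply, ell2_smul_apply, delta_apply_of_ne hx,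
    delta_apply_of_ne hy, mul_zero, mul_zero, add_zero]

theorem eq_sum_delta (s : Finset G) (f : ell2 G) (hf : ∀ x ∉ s, f x = 0) :
    f = ∑ x ∈ s, f x • delta x := by
  classical
  ext z
  simp only [lp.coeFn_sum, Finset.sum_apply, lp.coeFn_smul, Pi.smul_apply, smul_eq_mul]
  by_cases hz : z ∈ s
  · rw [Finset.sum_eq_single_of_mem z hz]
    · rw [delta_apply_self, mul_one]
    · intro y _ hy
      rw [delta_apply_of_ne hy.symm, mul_zero]
  · rw [hf z hz, Finset.sum_eq_zero]
    intro y hy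
    rw [delta_apply_of_ne (ne_of_mem_of_not_mem hy hz).symm, mul_zero]

theorem norm_permOp_apply (σ : G ≃ G) (f : ell2 G) : ‖permOp σ f‖ = ‖f‖ :=
  by
  simp only [permOp, LinearIsometry.coe_toContinuousLinearMap, LinearIsometry.norm_map]

theorem permOp_permOp_symm (σ : G ≃ G) : permOp σ * permOp σ.symm = 1 := by
  ext f x
  simp [permOp_apply]

theorem inner_permOp_permOp (σ : G ≃ G) (f g : ell2 G) :
    inner ℂ (permOp σ f) (permOp σ g) = inner ℂ f g :=
  by
  simp only [permOp, LinearIsometry.coe_toContinuousLinearMap, LinearIsometry.inner_map_map]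

theorem star_permOp (σ : G ≃ G) : star (permOp σ) = permOp σ.symm := by
  rw [ContinuousLinearMap.star_eq_adjoint, eq_comm, ContinuousLinearMap.eq_adjoint_iff]
  intro f g
  rw [← inner_permOp_permOp σ (permOp σ.symm f) g]
  congr 1
  exact congrArg (fun T => T f) (permOp_permOp_symm σ)

end Ell2

/-! ### The range of the projection `P` -/

section EtaSpan

variable {G : Type*} [Group G] (B : FreeGroupBasis (Fin 2) G)

/-- The vector `α δ_{a^i x} + β δ_{a^j x}`. -/
def pair (i j : ℤ) (x : G) (α β : ℝ) : ell2 G :=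
  (α : ℂ) • delta (B 0 ^ i * x) + (β : ℂ) • delta (B 0 ^ j * x)

theorem etaPrime_eq_pair (N k : ℕ) (x : G) : etaPrime B N k x =
    pair B ((k : ℤ) - N) k x (Real.sqrt ((k : ℝ) / N)) (Real.sqrt (((N : ℝ) - k) / N)) := rfl

theorem pair_sub_pair (i j : ℤ) (x : G) (α β α' β' : ℝ) :
    pair B i j x α β - pair B i j x α' β' = pair B i j x (α - α') (β - β') := by
  simp only [pair, Complex.ofReal_sub, sub_smul]
  abel

theorem pair_comm (i j : ℤ) (x : G) (α β : ℝ) : pair B i j x α β = pair B j i x β α :=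
  add_comm _ _

theorem pair_sqrt_one_sqrt_zero (i j : ℤ) (x : G) :
    pair B i j x (Real.sqrt 1) (Real.sqrt 0) = delta (B 0 ^ i * x) := by
  simp [pair]

theorem etaPrime_zero {N : ℕ} (hN : 0 < N) (x : G) : etaPrime B N 0 x = delta x := by
  simp [etaPrime, hN.ne']

theorem leftRegular_pair (n i j : ℤ) (x : G) (α β : ℝ) :
    leftRegular (B 0 ^ n) (pair B i j x α β) = pair B (i + n) (j + n) x α β := by
  simp only [pair, map_add, map_smul, leftRegular_delta, ← mul_assoc, ← zpow_add, add_comm n]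

variable {B}

theorem norm_sq_pair {i j : ℤ} (hij : i ≠ j) {x : G} (hx : x ∈ base B) (α β : ℝ) :
    ‖pair B i j x α β‖ ^ 2 = α ^ 2 + β ^ 2 := by
  rw [pair, norm_sq_smul_delta_add fun h => hij (zpow_mul_inj B hx hx h).1]
  simp

/-- Vectors `pair B i j x α β` with `i ≡ j` modulo `N` are orthogonal if their cosets or their
residues modulo `N` differ. -/
theorem inner_pair_eq_zero {N i j i' j' : ℤ} (hij : i ≡ j [ZMOD N]) (hij' : i' ≡ j' [ZMOD N])
    {x x' : G} (hx : x ∈ base B) (hx' : x' ∈ base B) (h : x = x' → ¬ i ≡ i' [ZMOD N])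
    (α β α' β' : ℝ) : inner ℂ (pair B i j x α β) (pair B i' j' x' α' β') = 0 := by
  refine inner_eq_zero_of_disjoint fun z => or_iff_not_imp_left.2 fun hz => ?_
  have key : ∀ l l' : ℤ, l ≡ i [ZMOD N] → l' ≡ i' [ZMOD N] → B 0 ^ l * x ≠ B 0 ^ l' * x' := by
    intro l l' hl hl' hll
    obtain ⟨rfl, rfl⟩ := zpow_mul_inj B hx hx' hll
    exact h rfl (hl.symm.trans hl')
  have hz' : z = B 0 ^ i * x ∨ z = B 0 ^ j * x := by
    by_contra! hc
    exact hz (smul_delta_add_apply_eq_zero _ _ hc.1 hc.2)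
  rcases hz' with rfl | rfl
  · exact smul_delta_add_apply_eq_zero _ _ (key _ _ rfl rfl) (key _ _ rfl hij'.symm)
  · exact smul_delta_add_apply_eq_zero _ _ (key _ _ hij.symm rfl) (key _ _ hij.symm hij'.symm)

theorem etaPrime_mem {N R k : ℕ} {x : G} (hk : k < N) (hx : x ∈ base B) (hR : len B x ≤ R) :
    etaPrime B N k x ∈ etaSpan B N R :=
  Submodule.subset_span ⟨(k, x), ⟨hk, hR, hx⟩, rfl⟩

theorem norm_etaPrime {N k : ℕ} {x : G} (hk : k < N) (hx : x ∈ base B) :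
    ‖etaPrime B N k x‖ = 1 := by
  have hN : (0 : ℝ) < N := by exact_mod_cast (Nat.zero_le k).trans_lt hk
  have hkN : (k : ℝ) ≤ N := by exact_mod_cast hk.le
  have h : ‖etaPrime B N k x‖ ^ 2 = 1 := by
    rw [etaPrime_eq_pair, norm_sq_pair (by omega) hx, Real.sq_sqrt (by positivity),
      Real.sq_sqrt (div_nonneg (by linarith) hN.le)]
    field_simp
    ring
  nlinarith [norm_nonneg (etaPrime B N k x)]

theorem sub_modEq_self (k N : ℤ) : k - N ≡ k [ZMOD N] :=
  (Int.modEq_iff_dvd.2 ⟨1, by ring⟩)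

theorem not_modEq_of_lt {N k k' : ℕ} (hk : k < N) (hk' : k' < N) (h : k ≠ k') (n : ℤ) :
    ¬ (k : ℤ) + n ≡ k' + n [ZMOD N] := fun hm =>
  h (Nat.ModEq.eq_of_lt_of_lt ((Int.natCast_modEq_iff).1 (Int.ModEq.add_right_cancel' n hm)) hk hk')

theorem inner_etaPrime_eq_zero {N k k' : ℕ} {x x' : G} (hk : k < N) (hk' : k' < N)
    (hx : x ∈ base B) (hx' : x' ∈ base B) (h : (k, x) ≠ (k', x')) :
    inner ℂ (etaPrime B N k x) (etaPrime B N k' x') = 0 := by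
  refine inner_pair_eq_zero (N := N) (sub_modEq_self _ _) (sub_modEq_self _ _) hx hx' ?_ _ _ _ _
  rintro rfl hm
  refine not_modEq_of_lt hk hk' (fun hkk => h (by rw [hkk])) (-N) ?_
  simpa only [sub_eq_add_neg] using hm

theorem sqrt_sub_sqrt_sq_le {s t c : ℝ} (hs : 0 ≤ s) (ht : 0 ≤ t) (h : |s - t| ≤ c) :
    (Real.sqrt s - Real.sqrt t) ^ 2 ≤ c := by
  have h1 := Real.sq_sqrt hs
  have h2 := Real.sq_sqrt ht
  have h3 := Real.sqrt_nonneg s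
  have h4 := Real.sqrt_nonneg t
  rcases abs_le.1 h with ⟨h5, h6⟩
  rcases le_total (Real.sqrt s) (Real.sqrt t) with h7 | h7 <;> nlinarith

/-- Multiplication by `a^{±1}` takes `η'(k, x)` to `η'(k ± 1, x)`, the index being read cyclically
modulo `N`, up to an error of norm at most `√(2/N)`. -/
theorem exists_leftRegular_etaPrime {N k : ℕ} (hk : k < N) {n : ℤ} (hn : n = 1 ∨ n = -1) (x : G) :
    ∃ (k' : ℕ) (i j : ℤ) (α β : ℝ), k' < N ∧ i ≠ j ∧ i ≡ k + n [ZMOD N] ∧ j ≡ k + n [ZMOD N] ∧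
      α ^ 2 + β ^ 2 ≤ 2 / N ∧
      leftRegular (B 0 ^ n) (etaPrime B N k x) = etaPrime B N k' x + pair B i j x α β := by
  have hN : (0 : ℝ) < N := by exact_mod_cast (Nat.zero_le k).trans_lt hk
  have hkN : (k : ℝ) + 1 ≤ N := by exact_mod_cast hk
  have h0 : (0 : ℝ) ≤ k := Nat.cast_nonneg k
  have h2 : (2 : ℝ) / N = 1 / N + 1 / N := by ring
  have hmod : (k : ℤ) - N + n ≡ k + n [ZMOD N] := (sub_modEq_self _ _).add_right n
  -- In the first two cases the index passes from `N - 1` to `0` or back, and one of the two terms of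
  -- `η'(0, x) = δ_x` has coefficient zero, so that its exponent may be adjusted by `N`.
  by_cases hwrap : (n = 1 ∧ k + 1 = N) ∨ (n = -1 ∧ k = 0)
  · rcases hwrap with ⟨rfl, hk1⟩ | ⟨rfl, rfl⟩
    · have hk1' : (N : ℝ) = k + 1 := by exact_mod_cast hk1.symm
      refine ⟨0, k - N + 1, k + 1, Real.sqrt (k / N) - Real.sqrt 1,
        Real.sqrt ((N - k) / N) - Real.sqrt 0, by omega, by omega, hmod, rfl, ?_,
        (sub_eq_iff_eq_add'.1 ?_)⟩
      rotate_left
      · have h : etaPrime B N 0 x = pair B (k - N + 1) (k + 1) x (Real.sqrt 1) (Real.sqrt 0) := by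
          have e1 : (k : ℤ) - N + 1 = 0 := by omega
          rw [pair_sqrt_one_sqrt_zero, e1, zpow_zero, one_mul, etaPrime_zero B (by omega)]
        rw [etaPrime_eq_pair, leftRegular_pair, h, pair_sub_pair]
      · rw [h2]
        refine add_le_add (sqrt_sub_sqrt_sq_le (by positivity) zero_le_one ?_)
          (sqrt_sub_sqrt_sq_le (div_nonneg (by linarith) hN.le) le_rfl ?_)
        · rw [hk1', abs_le]
          constructor <;> field_simp <;> linarith
        · rw [hk1', abs_le]
          constructor <;> field_simp <;> linarith
    · refine ⟨N - 1, N - 1, -1, Real.sqrt 0 - Real.sqrt (((N : ℝ) - (N - 1 : ℕ)) / N),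
        Real.sqrt 1 - Real.sqrt ((N - 1 : ℕ) / N), by omega, by omega, ?_, by simp, ?_,
        (sub_eq_iff_eq_add'.1 ?_)⟩
      · exact Int.modEq_iff_dvd.2 ⟨-1, by push_cast; ring⟩
      rotate_left
      · have h : leftRegular (B 0 ^ (-1 : ℤ)) (etaPrime B N 0 x)
            = pair B (N - 1) (-1) x (Real.sqrt 0) (Real.sqrt 1) := by
          rw [pair_comm, pair_sqrt_one_sqrt_zero, etaPrime_zero B hk, leftRegular_delta]
        have h' : etaPrime B N (N - 1) x = pair B (N - 1) (-1) x
            (Real.sqrt (((N : ℝ) - (N - 1 : ℕ)) / N)) (Real.sqrt ((N - 1 : ℕ) / N)) := by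
          rw [etaPrime_eq_pair, pair_comm, Nat.cast_sub hk, Nat.cast_sub hk]
          congr 1
          push_cast
          ring
        rw [h, h', pair_sub_pair]
      · rw [h2, Nat.cast_sub hk]
        push_cast
        refine add_le_add (sqrt_sub_sqrt_sq_le le_rfl (div_nonneg (by linarith) hN.le) ?_)
          (sqrt_sub_sqrt_sq_le zero_le_one (div_nonneg (by linarith) hN.le) ?_)
        · rw [abs_le]
          constructor <;> field_simp <;> linarith
        · rw [abs_le]
          constructor <;> field_simp <;> linarith
  · obtain ⟨k', hk'⟩ : ∃ k' : ℕ, (k' : ℤ) = k + n := ⟨(k + n).toNat, by omega⟩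
    refine ⟨k', k - N + n, k + n, Real.sqrt (k / N) - Real.sqrt (k' / N),
      Real.sqrt ((N - k) / N) - Real.sqrt ((N - k') / N), by omega, by omega, hmod, rfl, ?_,
      (sub_eq_iff_eq_add'.1 ?_)⟩
    rotate_left
    · have h : etaPrime B N k' x = pair B (k - N + n) (k + n) x (Real.sqrt (k' / N))
          (Real.sqrt ((N - k') / N)) := by
        rw [etaPrime_eq_pair, hk']
        congr 1
        ring
      rw [etaPrime_eq_pair, leftRegular_pair, h, pair_sub_pair]
    · have hk'' : (k' : ℝ) = k + n := by exact_mod_cast hk'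
      have hk3 : (k' : ℝ) ≤ N := by
        have : k' ≤ N := by omega
        exact_mod_cast this
      have hab : |(n : ℝ)| = 1 := by rcases hn with rfl | rfl <;> simp
      rw [h2]
      refine add_le_add (sqrt_sub_sqrt_sq_le (by positivity) (by positivity) ?_)
        (sqrt_sub_sqrt_sq_le (div_nonneg (by linarith) hN.le) (div_nonneg (by linarith) hN.le) ?_)
      · rw [← sub_div, abs_div, abs_of_pos hN, hk'', sub_add_cancel_left, abs_neg, hab]
      · rw [← sub_div, abs_div, abs_of_pos hN, hk'', sub_sub_sub_cancel_left, add_sub_cancel_left,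
          hab]

/-- If `|m|` is small compared to `N`, then `δ_{a^m x}` is close to one of the vectors
`η'(k, x)`. -/
theorem exists_delta_eq {N R : ℕ} (hR : R < N) {m : ℤ} (hm : m.natAbs ≤ R) (x : G) :
    ∃ (k' : ℕ) (i j : ℤ) (α β : ℝ), k' < N ∧ i ≠ j ∧ i ≡ m [ZMOD N] ∧ j ≡ m [ZMOD N] ∧
      α ^ 2 + β ^ 2 ≤ 2 * R / N ∧
      delta (B 0 ^ m * x) = etaPrime B N k' x + pair B i j x α β := by
  have hN : (0 : ℝ) < N := by exact_mod_cast (Nat.zero_le R).trans_lt hR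
  have hRN : (R : ℝ) < N := by exact_mod_cast hR
  have h2 : (2 : ℝ) * R / N = R / N + R / N := by ring
  -- The index `k'` is the residue of `m` modulo `N`; the dominant term of `η'(k', x)` is the second
  -- one for `m ≥ 0` and the first one for `m < 0`.
  rcases le_or_gt 0 m with h0 | h0
  · obtain ⟨k, rfl⟩ := Int.eq_ofNat_of_zero_le h0
    have hkR : (k : ℝ) ≤ R := by exact_mod_cast hm
    have hk0 : (0 : ℝ) ≤ k := Nat.cast_nonneg k
    refine ⟨k, k - N, k, Real.sqrt 0 - Real.sqrt (k / N), Real.sqrt 1 - Real.sqrt ((N - k) / N),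
      by omega, by omega, sub_modEq_self _ _, rfl, ?_, (sub_eq_iff_eq_add'.1 ?_)⟩
    · rw [h2]
      refine add_le_add (sqrt_sub_sqrt_sq_le le_rfl (by positivity) ?_)
        (sqrt_sub_sqrt_sq_le zero_le_one (div_nonneg (by linarith) hN.le) ?_)
      · rw [abs_le]
        constructor <;> field_simp <;> linarith
      · rw [abs_le]
        constructor <;> field_simp <;> linarith
    · rw [etaPrime_eq_pair, ← pair_sub_pair]
      simp [pair]
  · obtain ⟨k, hk⟩ : ∃ k : ℕ, (k : ℤ) = N + m := ⟨(N + m).toNat, by omega⟩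
    have hk' : (N : ℝ) - k ≤ R := by
      have : N ≤ k + R := by omega
      have : (N : ℝ) ≤ k + R := by exact_mod_cast this
      linarith
    have hkN : (k : ℝ) ≤ N := by
      have : k ≤ N := by omega
      exact_mod_cast this
    refine ⟨k, k - N, k, Real.sqrt 1 - Real.sqrt (k / N), Real.sqrt 0 - Real.sqrt ((N - k) / N),
      by omega, by omega, ?_, ?_, ?_, (sub_eq_iff_eq_add'.1 ?_)⟩
    · rw [hk, add_sub_cancel_left]
    · exact Int.modEq_iff_dvd.2 ⟨-1, by rw [hk]; ring⟩
    · rw [h2]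
      refine add_le_add (sqrt_sub_sqrt_sq_le zero_le_one (by positivity) ?_)
        (sqrt_sub_sqrt_sq_le le_rfl (div_nonneg (by linarith) hN.le) ?_)
      · rw [abs_le]
        constructor <;> field_simp <;> linarith
      · rw [abs_le]
        constructor <;> field_simp <;> linarith
    · rw [etaPrime_eq_pair, ← pair_sub_pair]
      simp [pair, hk]

/-- The range of `P` is almost invariant under `λ_a` and its inverse. -/
theorem norm_starProjection_orthogonal_leftRegular_le {N R : ℕ} {n : ℤ}
    (hn : n = 1 ∨ n = -1) {ξ : ell2 G} (hξ : ξ ∈ etaSpan B N R) :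
    ‖(etaSpan B N R)ᗮ.starProjection (leftRegular (B 0 ^ n) ξ)‖ ≤ Real.sqrt (2 / N) * ‖ξ‖ := by
  set s := (F_finite B N R).toFinset with hs
  have hmem : ∀ p ∈ s, p.1 < N ∧ len B p.2 ≤ R ∧ p.2 ∈ base B := fun p hp =>
    (F_finite B N R).mem_toFinset.1 hp
  have hξ' : ξ ∈ Submodule.span ℂ ((fun p : ℕ × G => etaPrime B N p.1 p.2) '' s) := by
    rw [hs, Set.Finite.coe_toFinset]
    exact hξ
  obtain ⟨c, rfl⟩ := (Submodule.mem_span_image_finset_iff_exists_fun' ℂ).1 hξ'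
  have hex := fun (p : ℕ × G) (hp : p ∈ s) =>
    exists_leftRegular_etaPrime (B := B) (hmem p hp).1 hn p.2
  choose! k' i j α β h using hex
  refine norm_starProjection_orthogonal_sum_le (etaSpan B N R) s
    (fun p => etaPrime B N p.1 p.2) (fun p => etaPrime B N (k' p) p.2)
    (fun p => pair B (i p) (j p) p.2 (α p) (β p)) c (Real.sqrt_nonneg _) ?_ ?_ ?_ ?_ ?_ ?_
  · exact fun p hp => etaPrime_mem (h p hp).1 (hmem p hp).2.2 (hmem p hp).2.1
  · exact fun p hp => norm_etaPrime (hmem p hp).1 (hmem p hp).2.2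
  · exact fun p hp q hq hpq => inner_etaPrime_eq_zero (hmem p hp).1 (hmem q hq).1
      (hmem p hp).2.2 (hmem q hq).2.2 hpq
  · intro p hp q hq hpq
    obtain ⟨-, -, hip, hjp, -⟩ := h p hp
    obtain ⟨-, -, hiq, hjq, -⟩ := h q hq
    refine inner_pair_eq_zero (hip.trans hjp.symm) (hiq.trans hjq.symm) (hmem p hp).2.2
      (hmem q hq).2.2 (fun hx hm => ?_) _ _ _ _
    refine not_modEq_of_lt (hmem p hp).1 (hmem q hq).1 (fun hk => hpq (Prod.ext hk hx)) n ?_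
    exact hip.symm.trans (hm.trans hiq)
  · intro p hp
    obtain ⟨-, hij, -, -, hle, -⟩ := h p hp
    rw [norm_sq_pair hij (hmem p hp).2.2, Real.sq_sqrt (by positivity)]
    exact hle
  · rw [map_sum]
    refine Finset.sum_congr rfl fun p hp => ?_
    rw [map_smul, (h p hp).2.2.2.2.2]

theorem finite_ball (R : ℕ) : {x : G | len B x ≤ R}.Finite :=
  Set.Finite.preimage (word_injective B).injOn (List.finite_length_le (Fin 2 × Bool) R)

/-- The range of `P` almost contains the functions supported in the ball of radius `R`. -/
theorem norm_starProjection_orthogonal_ball_le {N R : ℕ} (hR : 2 * R < N) {f : ell2 G}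
    (hf : ∀ y, R < len B y → f y = 0) :
    ‖(etaSpan B N R)ᗮ.starProjection f‖ ≤ Real.sqrt (2 * R / N) * ‖f‖ := by
  set s := (finite_ball (B := B) R).toFinset with hs
  have hmem : ∀ y ∈ s, len B y ≤ R := fun y hy => by simpa [hs] using hy
  have hsum : f = ∑ y ∈ s, f y • delta y := eq_sum_delta s f fun y hy =>
    hf y (by simpa [hs] using hy)
  have hex : ∀ y ∈ s, ∃ (m : ℤ) (x : G) (k' : ℕ) (i j : ℤ) (α β : ℝ), y = B 0 ^ m * x ∧
      x ∈ base B ∧ m.natAbs ≤ R ∧ len B x ≤ R ∧ k' < N ∧ i ≠ j ∧ i ≡ m [ZMOD N] ∧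
      j ≡ m [ZMOD N] ∧ α ^ 2 + β ^ 2 ≤ 2 * R / N ∧
      delta y = etaPrime B N k' x + pair B i j x α β := by
    intro y hy
    obtain ⟨m, x, hx, rfl⟩ := exists_zpow_mul B y
    have hl := hmem _ hy
    rw [len_zpow_mul B hx] at hl
    obtain ⟨k', i, j, α, β, h⟩ := exists_delta_eq (B := B) (N := N) (R := R) (by omega)
      (m := m) (by omega) x
    exact ⟨m, x, k', i, j, α, β, rfl, hx, by omega, by omega, h⟩
  choose! m x k' i j α β h using hex
  conv_rhs => rw [hsum]
  refine norm_starProjection_orthogonal_sum_le (etaSpan B N R) s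
    delta (fun y => etaPrime B N (k' y) (x y))
    (fun y => pair B (i y) (j y) (x y) (α y) (β y)) f (Real.sqrt_nonneg _) ?_ ?_ ?_ ?_ ?_ ?_
  · intro y hy
    obtain ⟨-, hx, -, hl, hk, -⟩ := h y hy
    exact etaPrime_mem hk hx hl
  · exact fun y _ => norm_delta y
  · exact fun y _ z _ hyz => inner_delta_of_ne hyz
  · intro y hy z hz hyz
    obtain ⟨hy0, hxy, hmy, -, -, -, hiy, hjy, -⟩ := h y hy
    obtain ⟨hz0, hxz, hmz, -, -, -, hiz, hjz, -⟩ := h z hz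
    refine inner_pair_eq_zero (hiy.trans hjy.symm) (hiz.trans hjz.symm) hxy hxz
      (fun hx hm => hyz ?_) _ _ _ _
    -- The residue modulo `N` determines an exponent of absolute value at most `R < N / 2`.
    have hmm : m y = m z := by
      obtain ⟨q, hq⟩ := Int.modEq_iff_dvd.1 (hiy.symm.trans (hm.trans hiz))
      have hlt : |m z - m y| < N := by rw [abs_lt]; omega
      rw [hq, abs_mul, Nat.abs_cast] at hlt
      have hq0 : q = 0 := by
        by_contra hq0
        nlinarith [Int.one_le_abs hq0]
      rw [hq0] at hq
      linarith
    rw [hy0, hz0, hmm, hx]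
  · intro y hy
    obtain ⟨-, hxy, -, -, -, hij, -, -, hle, -⟩ := h y hy
    rw [norm_sq_pair hij hxy, Real.sq_sqrt (by positivity)]
    exact hle
  · conv_lhs => rw [hsum]
    refine Finset.sum_congr rfl fun y hy => ?_
    rw [← (h y hy).2.2.2.2.2.2.2.2.2]

/-- The vectors in the range of `P` vanish on the cosets of `x` with `|x| > R`. -/
theorem apply_eq_zero_of_mem_etaSpan {N R : ℕ} {ξ : ell2 G} (hξ : ξ ∈ etaSpan B N R) (j : ℤ)
    {x : G} (hx : x ∈ base B) (hR : R < len B x) : ξ (B 0 ^ j * x) = 0 := by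
  induction hξ using Submodule.span_induction with
  | mem v hv =>
    obtain ⟨⟨k, z⟩, ⟨-, hz, hzb⟩, rfl⟩ := hv
    have hne : ∀ l : ℤ, B 0 ^ j * x ≠ B 0 ^ l * z := fun l hl => by
      have := (zpow_mul_inj B hx hzb hl).2
      subst this
      exact absurd hz (by simpa using hR)
    exact smul_delta_add_apply_eq_zero _ _ (hne _) (hne _)
  | zero => rfl
  | add v w _ _ hv hw => rw [ell2_add_apply, hv, hw, add_zero]
  | smul c v _ hv => rw [ell2_smul_apply, hv, mul_zero]

end EtaSpan

/-! ### Commutators with projections -/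

section Commutator

variable {H : Type*} [NormedAddCommGroup H] [InnerProductSpace ℂ H] [CompleteSpace H]

/-- The commutator of `T` with the projection onto `K` is the difference of the off-diagonal
corners of `T`, which have orthogonal domains and ranges. -/
theorem norm_comm_starProjection_le (K : Submodule ℂ H) [K.HasOrthogonalProjection]
    (T : H →L[ℂ] H) {c : ℝ} (hc : 0 ≤ c)
    (h1 : ∀ ξ ∈ K, ‖Kᗮ.starProjection (T ξ)‖ ≤ c * ‖ξ‖)
    (h2 : ∀ ξ ∈ K, ‖Kᗮ.starProjection (star T ξ)‖ ≤ c * ‖ξ‖) :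
    ‖comm T K.starProjection‖ ≤ c := by
  refine ContinuousLinearMap.opNorm_le_bound _ hc fun ξ => ?_
  set p := K.starProjection ξ
  set q := Kᗮ.starProjection ξ
  have hpK : p ∈ K := K.starProjection_apply_mem ξ
  have hpq : ξ = p + q := (K.starProjection_add_starProjection_orthogonal ξ).symm
  have hcomm : comm T K.starProjection ξ
      = Kᗮ.starProjection (T p) + -K.starProjection (T q) := by
    have h3 : K.starProjection (T p) + Kᗮ.starProjection (T p) = T p :=
      K.starProjection_add_starProjection_orthogonal (T p)
    have h4 : comm T K.starProjection ξ = T p - K.starProjection (T ξ) := rfl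
    rw [h4, hpq, map_add, map_add]
    nth_rewrite 1 [← h3]
    abel
  have hq2 : ‖K.starProjection (T q)‖ ≤ c * ‖q‖ := by
    -- This corner is the adjoint of `P⊥ T* P`.
    set w := K.starProjection (T q) with hw
    have hwK : w ∈ K := K.starProjection_apply_mem _
    have h5 : inner ℂ w w = inner ℂ (Kᗮ.starProjection (star T w)) q := by
      have e1 : inner ℂ w w = inner ℂ w (T q) := by
        nth_rewrite 2 [hw]
        rw [← K.inner_starProjection_left_eq_right,
          K.starProjection_eq_self_iff.2 hwK]
      rw [e1, ContinuousLinearMap.star_eq_adjoint, Kᗮ.inner_starProjection_left_eq_right,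
        ← ContinuousLinearMap.adjoint_inner_left]
      congr 1
      exact (Kᗮ.starProjection_eq_self_iff.2 (Kᗮ.starProjection_apply_mem ξ)).symm
    have h6 : ‖w‖ * ‖w‖ ≤ c * ‖w‖ * ‖q‖ := by
      calc ‖w‖ * ‖w‖ = ‖inner ℂ w w‖ := by
            rw [inner_self_eq_norm_sq_to_K]; simp [sq]
        _ ≤ ‖Kᗮ.starProjection (star T w)‖ * ‖q‖ := by rw [h5]; exact norm_inner_le_norm _ _
        _ ≤ c * ‖w‖ * ‖q‖ := by gcongr; exact h2 w hwK
    rcases (norm_nonneg w).eq_or_lt with h0 | h0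
    · rw [← h0]; positivity
    · refine le_of_mul_le_mul_left ?_ h0
      linarith
  have hort : inner ℂ (Kᗮ.starProjection (T p)) (-K.starProjection (T q)) = 0 := by
    rw [inner_neg_right, neg_eq_zero]
    exact Submodule.inner_left_of_mem_orthogonal (K.starProjection_apply_mem _)
      (Kᗮ.starProjection_apply_mem _)
  have hpq' : inner ℂ p q = 0 :=
    Submodule.inner_right_of_mem_orthogonal hpK (Kᗮ.starProjection_apply_mem _)
  refine abs_le_of_sq_le_sq' ?_ (by positivity) |>.2
  rw [hcomm, norm_add_sq_of_inner_eq_zero hort, norm_neg, mul_pow]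
  conv_rhs => rw [hpq]
  rw [norm_add_sq_of_inner_eq_zero hpq', mul_add]
  have h7 := pow_le_pow_left₀ (norm_nonneg _) (h1 p hpK) 2
  have h8 := pow_le_pow_left₀ (norm_nonneg _) hq2 2
  rw [mul_pow] at h7 h8
  linarith

end Commutator

/-! ### The twisted projections -/

section Twisting

variable {G : Type*} [Group G] (B : FreeGroupBasis (Fin 2) G)

theorem leftRegular_apply (g : G) (f : ell2 G) (x : G) : leftRegular g f x = f (g⁻¹ * x) := rfl

theorem star_leftRegular (g : G) : star (leftRegular g) = leftRegular g⁻¹ := by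
  rw [leftRegular, star_permOp, Equiv.mulLeft_symm]
  rfl

theorem norm_leftRegular_apply (g : G) (f : ell2 G) : ‖leftRegular g f‖ = ‖f‖ :=
  norm_permOp_apply _ f

theorem U_apply (f : ell2 G) (x : G) : U B f x = f (swapAut B x) :=
  congrArg f ((swapAut B).symm_apply_eq.2 (swapAut_swapAut B x).symm)

theorem norm_U_apply (f : ell2 G) : ‖U B f‖ = ‖f‖ := norm_permOp_apply _ f

theorem inner_U_left (f g : ell2 G) : inner ℂ (U B f) g = inner ℂ f (U B g) := by
  have h : U B (U B g) = g := congrArg (fun T => T g) (U_mul_U B)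
  conv_lhs => rw [← h]
  exact inner_permOp_permOp _ _ _

theorem star_U : star (U B) = U B := by
  rw [ContinuousLinearMap.star_eq_adjoint, eq_comm, ContinuousLinearMap.eq_adjoint_iff]
  exact inner_U_left B

theorem star_V : star (V B) = (1 / 2 : ℂ) • (1 + U B) - (Complex.I / 2) • (1 - U B) := by
  simp only [V, star_add, star_smul, star_sub, star_one, star_U]
  simp only [map_div₀, map_one, map_ofNat, Complex.conj_I, neg_div, neg_smul, ← sub_eq_add_neg,
    Complex.star_def]

theorem star_V_mul_V : star (V B) * V B = 1 := by
  have hU := U_mul_U B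
  rw [star_V, V]
  simp only [smul_add, smul_sub, add_mul, mul_add, sub_mul, mul_sub, smul_mul_assoc,
    mul_smul_comm, one_mul, mul_one, hU, smul_smul]
  match_scalars
  · linear_combination (-1 / 2 : ℂ) * Complex.I_mul_I
  · linear_combination (1 / 2 : ℂ) * Complex.I_mul_I

theorem V_mul_star_V : V B * star (V B) = 1 := by
  have hU := U_mul_U B
  rw [star_V, V]
  simp only [smul_add, smul_sub, add_mul, mul_add, sub_mul, mul_sub, smul_mul_assoc,
    mul_smul_comm, one_mul, mul_one, hU, smul_smul]
  match_scalars
  · linear_combination (-1 / 2 : ℂ) * Complex.I_mul_I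
  · linear_combination (1 / 2 : ℂ) * Complex.I_mul_I

theorem V_mem_unitary : V B ∈ unitary (ell2 G →L[ℂ] ell2 G) :=
  Unitary.mem_iff.2 ⟨star_V_mul_V B, V_mul_star_V B⟩

theorem V_apply (f : ell2 G) (x : G) : V B f x =
    1 / 2 * (f x + f (swapAut B x)) + Complex.I / 2 * (f x - f (swapAut B x)) := by
  rw [← U_apply]
  rfl

/-- The operator `½ (λ_g + λ_h) - (s/2) (λ_g - λ_h) U`. For `h = α(g)` and `s = i` it is
`V* λ_g V`. -/
def twist (g h : G) (s : ℂ) : ell2 G →L[ℂ] ell2 G :=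
  (1 / 2 : ℂ) • (leftRegular g + leftRegular h) -
    (s / 2) • ((leftRegular g - leftRegular h) * U B)

theorem twist_swap (g h : G) (s : ℂ) : twist B g h s = twist B h g (-s) := by
  simp only [twist, sub_mul]
  module

theorem twist_apply (g h : G) (s : ℂ) (f : ell2 G) : twist B g h s f =
    (1 / 2 : ℂ) • (leftRegular g f + leftRegular h f) -
      (s / 2) • (leftRegular g (U B f) - leftRegular h (U B f)) := rfl

theorem leftRegular_mul_V (g : G) :
    leftRegular g * V B = V B * twist B g (swapAut B g) Complex.I := by
  have hT : ∀ (f : ell2 G) (x : G), twist B g (swapAut B g) Complex.I f x =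
      1 / 2 * (f (g⁻¹ * x) + f ((swapAut B g)⁻¹ * x)) -
        Complex.I / 2 * (f (swapAut B (g⁻¹ * x)) - f (swapAut B ((swapAut B g)⁻¹ * x))) := by
    intro f x
    rw [← U_apply, ← U_apply]
    rfl
  ext f x
  rw [mul_apply_eq_comp, mul_apply_eq_comp, leftRegular_apply, V_apply,
    V_apply, hT, hT]
  simp only [map_mul, map_inv, swapAut_swapAut]
  linear_combination (1 / 4 * (f (g⁻¹ * x) - f ((swapAut B g)⁻¹ * x)
    + f ((swapAut B g)⁻¹ * swapAut B x) - f (g⁻¹ * swapAut B x))) * Complex.I_mul_I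

theorem twist_eq (g : G) :
    twist B g (swapAut B g) Complex.I = star (V B) * leftRegular g * V B := by
  rw [mul_assoc, leftRegular_mul_V, ← mul_assoc, star_V_mul_V, one_mul]

theorem star_twist (g : G) : star (twist B g (swapAut B g) Complex.I) =
    twist B g⁻¹ (swapAut B g)⁻¹ Complex.I := by
  rw [← map_inv, twist_eq, twist_eq, star_mul, star_mul, star_star, star_leftRegular, mul_assoc]

theorem norm_comm_leftRegular_Q (g : G) (N R : ℕ) : ‖comm (leftRegular g) (Q B N R)‖ =
    ‖comm (twist B g (swapAut B g) Complex.I) (P B N R)‖ := by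
  have h : comm (leftRegular g) (Q B N R) =
      V B * comm (twist B g (swapAut B g) Complex.I) (P B N R) * star (V B) := by
    have h2 : star (V B) * leftRegular g = twist B g (swapAut B g) Complex.I * star (V B) := by
      rw [twist_eq, mul_assoc, V_mul_star_V, mul_one]
    rw [comm, comm, Q, ← mul_assoc, ← mul_assoc, leftRegular_mul_V, mul_assoc _ (star (V B)), h2]
    simp only [mul_sub, sub_mul, mul_assoc]
  rw [h, CStarRing.norm_mul_mem_unitary _ (Unitary.star_mem (V_mem_unitary B)),
    CStarRing.norm_mem_unitary_mul _ (V_mem_unitary B)]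

/-- If `s` is purely imaginary of modulus one, then `(1 + s U) / √2` is unitary, as `U` is
self-adjoint. -/
theorem norm_sq_add_smul_U {s : ℂ} (hs : s = Complex.I ∨ s = -Complex.I) (f : ell2 G) :
    ‖f + s • U B f‖ ^ 2 = 2 * ‖f‖ ^ 2 := by
  have hreal : (inner ℂ f (U B f)).im = 0 := by
    have h := inner_conj_symm (𝕜 := ℂ) f (U B f)
    rw [inner_U_left] at h
    exact Complex.conj_eq_iff_im.1 h
  have hre : RCLike.re (inner ℂ f (s • U B f)) = 0 := by
    rw [inner_smul_right]
    rcases hs with rfl | rfl <;> simp [hreal]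
  have hs1 : ‖s‖ = 1 := by rcases hs with rfl | rfl <;> simp
  rw [norm_add_sq (𝕜 := ℂ), hre, norm_smul, hs1, norm_U_apply]
  ring

/-- The corner estimate behind the constant `√3/2`. Up to small errors, `P⊥ T ξ` is the sum of
`½ λ_b (1 + s U) ξ` restricted to `base B` and of `-(s/2) λ_a U ξ` restricted to the complement of
`base B`; as `1 + s U` is `√2` times a unitary, the norm of this sum is at most
`(√(2 + 1) / 2) ‖ξ‖`. All other terms are almost in the range of `P`. -/
theorem norm_starProjection_orthogonal_twist_le {N R : ℕ} (hR : 2 * R < N) {n : ℤ}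
    (hn : n = 1 ∨ n = -1) {s : ℂ} (hs : s = Complex.I ∨ s = -Complex.I) {ξ : ell2 G}
    (hξ : ξ ∈ etaSpan B N R) :
    ‖(etaSpan B N R)ᗮ.starProjection (twist B (B 0 ^ n) (B 1 ^ n) s ξ)‖ ≤
      (Real.sqrt 3 / 2 + (1 / 2 * Real.sqrt (2 / N) + 3 / 2 * Real.sqrt (2 * R / N))) * ‖ξ‖ := by
  have hs1 : ‖s‖ = 1 := by rcases hs with rfl | rfl <;> simp
  have hc1 : ‖(1 / 2 : ℂ)‖ = 1 / 2 := by norm_num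
  have hc2 : ‖s / 2‖ = 1 / 2 := by rw [norm_div, hs1]; norm_num
  have hn' : -n = 1 ∨ -n = -1 := by omega
  set X : Set G := base B
  set Lb := leftRegular (B 1 ^ n) with hLb
  set La := leftRegular (B 0 ^ n) with hLa
  -- The next three terms are supported in the ball of radius `R`: left multiplication by
  -- `b^{-n}` takes words not beginning with a power of `b` to longer words in `base B`, and `ξ`
  -- vanishes on the cosets of the words in `base B` of length greater than `R`.
  have hball1 : ∀ y, R < len B y → restr Xᶜ (Lb ξ) y = 0 := by
    intro y hy
    by_cases hyX : y ∈ X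
    · exact restr_apply_of_notMem (by simpa using hyX) _
    · have h := zpow_one_mul_mem_base B (swapAut_mem_base_of_notMem B hyX) hn'
      rw [restr_apply_of_mem (by simpa using hyX), hLb, leftRegular_apply, ← zpow_neg]
      have h0 := apply_eq_zero_of_mem_etaSpan hξ 0 h.1 (by omega)
      rwa [zpow_zero, one_mul] at h0
  have hball2 : ∀ y, R < len B y → restr Xᶜ (Lb (U B ξ)) y = 0 := by
    intro y hy
    by_cases hyX : y ∈ X
    · exact restr_apply_of_notMem (by simpa using hyX) _
    · rw [restr_apply_of_mem (by simpa using hyX), hLb, leftRegular_apply, ← zpow_neg, U_apply,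
        swapAut_zpow_mul_one]
      exact apply_eq_zero_of_mem_etaSpan hξ _ (swapAut_mem_base_of_notMem B hyX)
        (by rwa [len_swapAut])
  have hball3 : ∀ y, R < len B y → restr X (La (U B ξ)) y = 0 := by
    intro y hy
    by_cases hyX : y ∈ X
    · have h := zpow_one_mul_mem_base B (y := swapAut B y) (by rwa [swapAut_swapAut]) hn'
      rw [len_swapAut] at h
      rw [restr_apply_of_mem hyX, hLa, leftRegular_apply, ← zpow_neg, U_apply,
        swapAut_zpow_mul_zero]
      have h0 := apply_eq_zero_of_mem_etaSpan hξ 0 h.1 (by omega)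
      rwa [zpow_zero, one_mul] at h0
    · exact restr_apply_of_notMem hyX _
  have hdecomp : twist B (B 0 ^ n) (B 1 ^ n) s ξ =
      ((1 / 2 : ℂ) • restr X (Lb (ξ + s • U B ξ)) + (-(s / 2)) • restr Xᶜ (La (U B ξ))) +
      ((1 / 2 : ℂ) • La ξ + (1 / 2 : ℂ) • restr Xᶜ (Lb ξ) + (s / 2) • restr Xᶜ (Lb (U B ξ)) +
        (-(s / 2)) • restr X (La (U B ξ))) := by
    have e1 := restr_add_restr_compl X (Lb ξ)
    have e2 := restr_add_restr_compl X (Lb (U B ξ))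
    have e3 := restr_add_restr_compl X (La (U B ξ))
    rw [twist_apply]
    simp only [← hLa, ← hLb, map_add, map_smul]
    conv_lhs => rw [← e1, ← e2, ← e3]
    module
  have hmain : ‖(1 / 2 : ℂ) • restr X (Lb (ξ + s • U B ξ)) + (-(s / 2)) • restr Xᶜ (La (U B ξ))‖ ≤
      Real.sqrt 3 / 2 * ‖ξ‖ := by
    refine abs_le_of_sq_le_sq' ?_ (by positivity) |>.2
    have hort : inner ℂ ((1 / 2 : ℂ) • restr X (Lb (ξ + s • U B ξ)))
        ((-(s / 2)) • restr Xᶜ (La (U B ξ))) = 0 := by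
      rw [inner_smul_left, inner_smul_right, inner_restr_restr_compl]
      simp
    have h1 := pow_le_pow_left₀ (norm_nonneg _) (norm_restr_apply_le X (Lb (ξ + s • U B ξ))) 2
    have h2 := pow_le_pow_left₀ (norm_nonneg _) (norm_restr_apply_le Xᶜ (La (U B ξ))) 2
    rw [norm_leftRegular_apply, norm_sq_add_smul_U B hs] at h1
    rw [norm_leftRegular_apply, norm_U_apply] at h2
    rw [norm_add_sq_of_inner_eq_zero hort, norm_smul, norm_smul, norm_neg, hc1, hc2,
      mul_pow, mul_pow, mul_pow, div_pow (Real.sqrt 3), Real.sq_sqrt (by norm_num)]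
    linarith
  have hU := norm_U_apply B ξ
  have herr1 := norm_starProjection_orthogonal_leftRegular_le hn hξ
  have herr2 := norm_starProjection_orthogonal_ball_le hR hball1
  have herr3 := norm_starProjection_orthogonal_ball_le hR hball2
  have herr4 := norm_starProjection_orthogonal_ball_le hR hball3
  have hle2 : ‖restr Xᶜ (Lb ξ)‖ ≤ ‖ξ‖ :=
    (norm_restr_apply_le _ _).trans_eq (norm_leftRegular_apply _ _)
  have hle3 : ‖restr Xᶜ (Lb (U B ξ))‖ ≤ ‖ξ‖ :=
    (norm_restr_apply_le _ _).trans_eq ((norm_leftRegular_apply _ _).trans hU)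
  have hle4 : ‖restr X (La (U B ξ))‖ ≤ ‖ξ‖ :=
    (norm_restr_apply_le _ _).trans_eq ((norm_leftRegular_apply _ _).trans hU)
  have hsq := Real.sqrt_nonneg (2 * R / N)
  replace herr2 := herr2.trans (mul_le_mul_of_nonneg_left hle2 hsq)
  replace herr3 := herr3.trans (mul_le_mul_of_nonneg_left hle3 hsq)
  replace herr4 := herr4.trans (mul_le_mul_of_nonneg_left hle4 hsq)
  rw [hdecomp, map_add]
  refine (norm_add_le _ _).trans ?_
  rw [add_mul]
  refine add_le_add ((Submodule.norm_starProjection_apply_le _ _).trans hmain) ?_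
  rw [map_add, map_add, map_add, map_smul, map_smul, map_smul, map_smul]
  refine (norm_add_le _ _).trans ((add_le_add ((norm_add_le _ _).trans (add_le_add
    (norm_add_le _ _) le_rfl)) le_rfl).trans ?_)
  rw [norm_smul, norm_smul, norm_smul, norm_smul, norm_neg, hc1, hc2]
  linarith

/-- The commutator estimate before simplifying the error term. -/
theorem norm_comm_leftRegular_Q_le {N R : ℕ} (hR : 2 * R < N) (i : Fin 2) :
    ‖comm (leftRegular (B i)) (Q B N R)‖ ≤
      Real.sqrt 3 / 2 + (1 / 2 * Real.sqrt (2 / N) + 3 / 2 * Real.sqrt (2 * R / N)) := by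
  rw [norm_comm_leftRegular_Q]
  refine norm_comm_starProjection_le _ _ (by positivity) (fun ξ hξ => ?_) (fun ξ hξ => ?_)
  · fin_cases i
    · have h := norm_starProjection_orthogonal_twist_le B hR (n := 1) (Or.inl rfl) (Or.inl rfl) hξ
      rw [zpow_one, zpow_one] at h
      simp only [Fin.zero_eta, swapAut_zero]
      exact h
    · have h := norm_starProjection_orthogonal_twist_le B hR (n := 1) (Or.inl rfl) (Or.inr rfl) hξ
      rw [zpow_one, zpow_one, ← twist_swap] at h
      simp only [Fin.mk_one, swapAut_one]
      exact h
  · rw [star_twist]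
    fin_cases i
    · have h := norm_starProjection_orthogonal_twist_le B hR (n := -1) (Or.inr rfl) (Or.inl rfl) hξ
      rw [zpow_neg_one, zpow_neg_one] at h
      simp only [Fin.zero_eta, swapAut_zero]
      exact h
    · have h := norm_starProjection_orthogonal_twist_le B hR (n := -1) (Or.inr rfl) (Or.inr rfl) hξ
      rw [zpow_neg_one, zpow_neg_one, ← twist_swap] at h
      simp only [Fin.mk_one, swapAut_one]
      exact h

/-- The error term under the growth condition: it implies `4 R ≤ N^{1/4}`, so that both square
roots are at most of order `N^{-3/8}`. -/
theorem error_le {N R : ℕ} (hN : 4 ≤ N) (hR1 : 1 ≤ R)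
    (h : (R : ℝ) * 4 ^ R ≤ (N : ℝ) ^ (1 / 4 : ℝ)) : 2 * R < N ∧
    1 / 2 * Real.sqrt (2 / N) + 3 / 2 * Real.sqrt (2 * R / N) ≤ (N : ℝ) ^ (-(1 / 9) : ℝ) := by
  have hN4 : (4 : ℝ) ≤ N := by exact_mod_cast hN
  have hN1 : (1 : ℝ) ≤ N := by linarith
  have hN0 : (0 : ℝ) < N := by linarith
  have hR1' : (1 : ℝ) ≤ R := by exact_mod_cast hR1
  have h4R : (4 : ℝ) ≤ 4 ^ R := by
    simpa using pow_le_pow_right₀ (by norm_num : (1 : ℝ) ≤ 4) hR1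
  have hRN : 4 * (R : ℝ) ≤ (N : ℝ) ^ (1 / 4 : ℝ) := by nlinarith
  constructor
  · have h1 : (N : ℝ) ^ (1 / 4 : ℝ) ≤ N := by
      simpa using Real.rpow_le_rpow_of_exponent_le hN1 (by norm_num : (1 / 4 : ℝ) ≤ 1)
    have h2 : (2 : ℝ) * R < N := by linarith
    exact_mod_cast h2
  · have h1 : Real.sqrt (2 / N) ≤ Real.sqrt (2 * R / N) := by
      apply Real.sqrt_le_sqrt
      gcongr
      linarith
    have h2 : Real.sqrt (8 * R / N) = 2 * Real.sqrt (2 * R / N) := by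
      rw [show (8 * R / N : ℝ) = 2 ^ 2 * (2 * R / N) by ring, Real.sqrt_mul (by positivity),
        Real.sqrt_sq (by norm_num)]
    have h3 : Real.sqrt (8 * R / N) ≤ (N : ℝ) ^ (-(1 / 9) : ℝ) := by
      rw [Real.sqrt_le_left (by positivity), ← Real.rpow_natCast, ← Real.rpow_mul hN0.le,
        div_le_iff₀ hN0]
      nth_rewrite 2 [← Real.rpow_one (N : ℝ)]
      rw [← Real.rpow_add hN0]
      have h5 : (2 : ℝ) ≤ (N : ℝ) ^ (1 / 2 : ℝ) := by
        rw [← Real.sqrt_eq_rpow]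
        exact Real.le_sqrt_of_sq_le (by linarith)
      calc (8 * R : ℝ) ≤ 2 * (N : ℝ) ^ (1 / 4 : ℝ) := by linarith
        _ ≤ (N : ℝ) ^ (1 / 2 : ℝ) * (N : ℝ) ^ (1 / 4 : ℝ) := by gcongr
        _ = (N : ℝ) ^ (1 / 2 + 1 / 4 : ℝ) := (Real.rpow_add hN0 _ _).symm
        _ ≤ _ := Real.rpow_le_rpow_of_exponent_le hN1 (by norm_num)
    linarith

theorem isFiniteRankProjection_Q (N R : ℕ) : IsFiniteRankProjection (Q B N R) := by
  have hP : IsStarProjection (P B N R) := isStarProjection_starProjection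
  refine ⟨⟨?_, ?_⟩, ?_⟩
  · have h : Q B N R * Q B N R =
        V B * (P B N R * (star (V B) * V B) * P B N R) * star (V B) := by
      simp only [Q, mul_assoc]
    rw [IsIdempotentElem, h, star_V_mul_V, mul_one, hP.isIdempotentElem.eq]
    rfl
  · rw [IsSelfAdjoint, Q, star_mul, star_mul, star_star, hP.isSelfAdjoint.star_eq, mul_assoc]
  · have hle : (Q B N R : ell2 G →ₗ[ℂ] ell2 G).range ≤
        (etaSpan B N R).map (V B : ell2 G →ₗ[ℂ] ell2 G) := by
      rintro _ ⟨f, rfl⟩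
      exact ⟨_, Submodule.starProjection_apply_mem _ (star (V B) f), rfl⟩
    exact Submodule.finiteDimensional_of_le hle

/-! ### Strong convergence -/

theorem tendsto_P_delta {R : ℕ → ℕ} (hR : Tendsto R atTop atTop) (y : G) :
    Tendsto (fun N => P B N (R N) (delta y)) atTop (𝓝 (delta y)) := by
  rw [tendsto_iff_norm_sub_tendsto_zero]
  obtain ⟨m, x, hx, rfl⟩ := exists_zpow_mul B y
  have hlim : Tendsto (fun N : ℕ => Real.sqrt (2 * m.natAbs / N)) atTop (𝓝 0) := by
    have h := (tendsto_const_div_atTop_nhds_zero_nat (2 * (m.natAbs : ℝ))).sqrt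
    rwa [Real.sqrt_zero] at h
  refine squeeze_zero' (Eventually.of_forall fun _ => norm_nonneg _) ?_ hlim
  filter_upwards [eventually_gt_atTop m.natAbs, hR.eventually_ge_atTop (len B x)] with N hN hRN
  obtain ⟨k, i, j, α, β, hk, hij, -, -, hle, heq⟩ := exists_delta_eq (B := B) hN le_rfl x
  have h1 : ‖P B N (R N) (delta (B 0 ^ m * x)) - delta (B 0 ^ m * x)‖ =
      ‖(etaSpan B N (R N))ᗮ.starProjection (pair B i j x α β)‖ := by
    have h2 := (etaSpan B N (R N)).starProjection_add_starProjection_orthogonal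
      (delta (B 0 ^ m * x))
    have h3 : (etaSpan B N (R N))ᗮ.starProjection (etaPrime B N k x) = 0 := by
      rw [Submodule.starProjection_apply_eq_zero_iff]
      exact Submodule.le_orthogonal_orthogonal _ (etaPrime_mem hk hx hRN)
    have h4 : (etaSpan B N (R N))ᗮ.starProjection (delta (B 0 ^ m * x)) =
        (etaSpan B N (R N))ᗮ.starProjection (pair B i j x α β) := by
      rw [heq, map_add, h3, zero_add]
    rw [← h4, norm_sub_rev]
    congr 1
    rw [sub_eq_iff_eq_add']
    exact h2.symm
  rw [h1]
  refine (Submodule.norm_starProjection_apply_le _ _).trans (Real.le_sqrt_of_sq_le ?_)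
  rwa [norm_sq_pair hij hx]

/-- The `P` are contractions, so strong convergence follows from that on the basis vectors. -/
theorem tendsto_P {R : ℕ → ℕ} (hR : Tendsto R atTop atTop) (f : ell2 G) :
    Tendsto (fun N => P B N (R N) f) atTop (𝓝 f) := by
  classical
  rw [Metric.tendsto_atTop]
  intro ε hε
  have hsum : HasSum (fun y => f y • (delta y : ell2 G)) f := by
    convert lp.hasSum_single (E := fun _ : G => ℂ) (p := 2) (by norm_num) f using 2 with y
    rw [delta, ← lp.single_smul]
    simp
  obtain ⟨s, hs⟩ := ((Metric.tendsto_nhds.1 hsum) (ε / 3) (by positivity)).exists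
  set g := ∑ y ∈ s, f y • (delta y : ell2 G) with hg
  have hgP : Tendsto (fun N => P B N (R N) g) atTop (𝓝 g) := by
    simp only [hg, map_sum, map_smul]
    exact tendsto_finsetSum _ fun y _ => (tendsto_P_delta B hR y).const_smul _
  obtain ⟨N₀, hN₀⟩ := Metric.tendsto_atTop.1 hgP (ε / 3) (by positivity)
  refine ⟨N₀, fun N hN => ?_⟩
  have h1 : dist (P B N (R N) f) (P B N (R N) g) ≤ dist f g := by
    rw [dist_eq_norm, dist_eq_norm, ← map_sub]
    exact Submodule.norm_starProjection_apply_le _ _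
  have h2 := dist_triangle4 (P B N (R N) f) (P B N (R N) g) g f
  have h3 := hN₀ N hN
  rw [dist_comm f g] at h1
  linarith

theorem tendsto_Q {R : ℕ → ℕ} (hR : Tendsto R atTop atTop) (f : ell2 G) :
    Tendsto (fun N => Q B N (R N) f) atTop (𝓝 f) := by
  have h := ((V B).continuous.tendsto _).comp (tendsto_P B hR (star (V B) f))
  have h2 : V B (star (V B) f) = f := congrArg (fun T => T f) (V_mul_star_V B)
  rw [h2] at h
  exact h

end Twisting

/-! ### The lower bound -/

section LowerBound

/-- The trace of `X ∑ⱼ |fⱼ⟩⟨fⱼ|` computed in two ways. -/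
theorem sum_inner_eq_sum_inner {H : Type*} [NormedAddCommGroup H] [InnerProductSpace ℂ H]
    {n m : ℕ} {Y : Submodule ℂ H} (e : OrthonormalBasis (Fin m) ℂ Y) (f : Fin n → H)
    (hf : ∀ j, f j ∈ Y) (X : H →L[ℂ] H) :
    ∑ i, inner ℂ (∑ j, inner ℂ (f j) (e i : H) • f j) (X (e i)) = ∑ j, inner ℂ (f j) (X (f j)) := by
  have h1 : ∀ j, ∑ i, inner ℂ (e i : H) (f j) • (e i : H) = f j := fun j => by
    have h := congrArg (fun y : Y => (y : H)) (e.sum_repr' ⟨f j, hf j⟩)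
    simpa using h
  simp only [sum_inner, inner_smul_left, inner_conj_symm]
  rw [Finset.sum_comm]
  refine Finset.sum_congr rfl fun j _ => ?_
  have h := congrArg (fun v => inner ℂ (f j) (X v)) (h1 j)
  simpa only [map_sum, inner_sum, map_smul, inner_smul_right] using h

variable {G : Type*} [Group G]

theorem norm_restr_leftRegular_inv {g : G} {S S' : Set G} (h : ∀ x, x ∈ S ↔ g * x ∈ S')
    (f : ell2 G) : ‖restr S (leftRegular g⁻¹ f)‖ = ‖restr S' f‖ := by
  have h1 : restr S (leftRegular g⁻¹ f) = leftRegular g⁻¹ (restr S' f) := by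
    ext x
    rw [leftRegular_apply, inv_inv]
    by_cases hx : x ∈ S
    · rw [restr_apply_of_mem hx, restr_apply_of_mem ((h x).1 hx), leftRegular_apply, inv_inv]
    · rw [restr_apply_of_notMem hx, restr_apply_of_notMem (fun h' => hx ((h x).2 h'))]
  rw [h1, norm_leftRegular_apply]

/-- The measure `S ↦ tr (P 1_S)` on `G`, where `P` is the projection onto `K`, is almost invariant
under translation by `g` if `P` almost commutes with `λ_g`. The operator `λ_g* P λ_g - P` has norm
at most `‖[λ_g, P]‖` and rank at most twice the rank of `P`. As it has trace zero, `1_S` may be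
replaced by `1_S - 1/2`, which has norm `1/2`. -/
theorem sum_norm_sq_restr_sub_le (K : Submodule ℂ (ell2 G)) [FiniteDimensional ℂ K] (g : G)
    {S S' : Set G} (hS : ∀ x, x ∈ S ↔ g * x ∈ S') :
    ∑ j, ‖restr S' (stdOrthonormalBasis ℂ K j : ell2 G)‖ ^ 2 -
      ∑ j, ‖restr S (stdOrthonormalBasis ℂ K j : ell2 G)‖ ^ 2 ≤
      Module.finrank ℂ K * ‖comm (leftRegular g) K.starProjection‖ := by
  set n := Module.finrank ℂ K
  set c := ‖comm (leftRegular g) K.starProjection‖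
  set f : Fin n → ell2 G := fun j => (stdOrthonormalBasis ℂ K j : ell2 G) with hf
  set L := leftRegular g⁻¹ with hL
  set Y := K ⊔ K.map (L : ell2 G →ₗ[ℂ] ell2 G) with hY
  have hdim : Module.finrank ℂ Y ≤ 2 * n := by
    have h1 := Submodule.finrank_add_le_finrank_add_finrank K
      (K.map (L : ell2 G →ₗ[ℂ] ell2 G))
    have h2 := Submodule.finrank_map_le (L : ell2 G →ₗ[ℂ] ell2 G) K
    rw [hY]
    omega
  set e := stdOrthonormalBasis ℂ Y
  have hfY : ∀ j, f j ∈ Y := fun j => Submodule.mem_sup_left (stdOrthonormalBasis ℂ K j).2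
  have hfY' : ∀ j, L (f j) ∈ Y := fun j =>
    Submodule.mem_sup_right ⟨f j, (stdOrthonormalBasis ℂ K j).2, rfl⟩
  have hPf : ∀ v, K.starProjection v = ∑ j, inner ℂ (f j) v • f j := fun v => by
    rw [(stdOrthonormalBasis ℂ K).starProjection_eq_sum_rankOne]
    simp [hf]
    rfl
  have hLg : ∀ v, L (leftRegular g v) = v := fun v => by
    ext x
    simp [hL, leftRegular_apply]
  have hPf' : ∀ v, L (K.starProjection (leftRegular g v)) =
      ∑ j, inner ℂ (L (f j)) v • L (f j) := fun v => by
    rw [hPf, map_sum]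
    refine Finset.sum_congr rfl fun j _ => ?_
    rw [map_smul, ← inner_permOp_permOp (Equiv.mulLeft g⁻¹) (f j)]
    congr 2
    exact hLg v
  have hA : ∀ v, ‖L (K.starProjection (leftRegular g v)) - K.starProjection v‖ ≤ c * ‖v‖ := by
    intro v
    have h1 : L (K.starProjection (leftRegular g v)) - K.starProjection v =
        -L (comm (leftRegular g) K.starProjection v) := by
      have h2 : comm (leftRegular g) K.starProjection v =
        leftRegular g (K.starProjection v) - K.starProjection (leftRegular g v) := rfl
      rw [h2, map_sub, hLg]
      abel
    rw [h1, norm_neg, norm_leftRegular_apply]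
    exact ContinuousLinearMap.le_opNorm _ _
  have htr : ∀ X : ell2 G →L[ℂ] ell2 G,
      ∑ j, inner ℂ (L (f j)) (X (L (f j))) - ∑ j, inner ℂ (f j) (X (f j)) =
      ∑ i, inner ℂ (L (K.starProjection (leftRegular g (e i))) - K.starProjection (e i))
        (X (e i)) := by
    intro X
    rw [← sum_inner_eq_sum_inner e _ hfY', ← sum_inner_eq_sum_inner e _ hfY]
    simp only [inner_sub_left, Finset.sum_sub_distrib, ← hPf, ← hPf']
  have h1 := htr (restr S)
  have h2 := htr 1
  have heunit : ∀ i, ‖(e i : ell2 G)‖ = 1 := fun i => e.orthonormal.1 i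
  -- The trace of `λ_g* P λ_g - P` is zero.
  have h3 : ∑ i, inner ℂ (L (K.starProjection (leftRegular g (e i))) - K.starProjection (e i))
      (e i : ell2 G) = 0 := by
    refine h2.symm.trans ?_
    simp only [one_apply_eq_self, inner_self_eq_norm_sq_to_K, hL, norm_leftRegular_apply,
      sub_self]
  have h4 : ((∑ j, ‖restr S' (f j)‖ ^ 2 - ∑ j, ‖restr S (f j)‖ ^ 2 : ℝ) : ℂ) =
      ∑ i, inner ℂ (L (K.starProjection (leftRegular g (e i))) - K.starProjection (e i))
        (restr S (e i) - (1 / 2 : ℂ) • (e i : ell2 G)) := by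
    simp only [inner_sub_right, inner_smul_right, Finset.sum_sub_distrib, ← Finset.mul_sum]
    rw [h3, mul_zero, sub_zero, ← h1]
    simp only [inner_restr_right, hL, norm_restr_leftRegular_inv hS]
    push_cast
    rfl
  calc ∑ j, ‖restr S' (f j)‖ ^ 2 - ∑ j, ‖restr S (f j)‖ ^ 2
      ≤ ‖((∑ j, ‖restr S' (f j)‖ ^ 2 - ∑ j, ‖restr S (f j)‖ ^ 2 : ℝ) : ℂ)‖ := by
        rw [Complex.norm_real]
        exact le_abs_self _
    _ ≤ ∑ i : Fin (Module.finrank ℂ Y), c * (1 / 2) := by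
        rw [h4]
        refine (norm_sum_le _ _).trans (Finset.sum_le_sum fun i _ => ?_)
        refine (norm_inner_le_norm _ _).trans ?_
        rw [norm_restr_sub_half_smul, heunit]
        have h5 := hA (e i)
        rw [heunit] at h5
        linarith
    _ = (Module.finrank ℂ Y : ℝ) / 2 * c := by
        rw [Finset.sum_const, Finset.card_univ, Fintype.card_fin, nsmul_eq_mul]
        ring
    _ ≤ n * c := by
        gcongr
        have h6 : (Module.finrank ℂ Y : ℝ) ≤ 2 * n := by exact_mod_cast hdim
        linarith

variable (B : FreeGroupBasis (Fin 2) G)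

theorem mem_W_inv_iff (i : Fin 2) (x : G) : x ∈ W B (B i)⁻¹ ↔ B i * x ∈ (W B (B i))ᶜ := by
  rw [Set.mem_compl_iff, inv_coe_eq_letter, coe_eq_letter, mem_W_letter, mem_W_letter]
  constructor
  · intro h h'
    obtain ⟨t, ht⟩ := List.head?_eq_some_iff.1 h
    obtain ⟨t', ht'⟩ := List.head?_eq_some_iff.1 h'
    obtain ⟨y, rfl, hy⟩ := exists_eq_letter_mul B ht
    obtain ⟨z, hz, hz'⟩ := exists_eq_letter_mul B ht'
    have h1 : letter B (i, false) * y = z := mul_left_cancel hz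
    rw [← h1, ht] at hz'
    have h2 : letter B (i, true) * (letter B (i, false) * y) = y := by simp [letter]
    rw [h2, hy] at ht'
    have h3 := congrArg List.length ht'
    have h4 := congrArg List.length hz'
    simp only [List.length_cons] at h3 h4
    omega
  · intro h
    by_contra h'
    exact h (by rw [word_letter_mul B (i, true) x h']; simp)

theorem disjoint_W_letter {l m : Fin 2 × Bool} (h : l ≠ m) :
    Disjoint (W B (letter B l)) (W B (letter B m)) := by
  rw [Set.disjoint_left]
  intro x hl hm
  rw [mem_W_letter] at hl hm
  exact h (Option.mem_unique hl hm)

/-- As `W_a`, `W_{a⁻¹}`, `W_b`, `W_{b⁻¹}` are disjoint and `a W_{a⁻¹}`, `b W_{b⁻¹}` are the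
complements of `W_a`, `W_b`, a nonzero finite rank projection cannot almost commute with both
`λ_a` and `λ_b`. -/
theorem half_le_max_norm_comm (K : Submodule ℂ (ell2 G)) [FiniteDimensional ℂ K] (hK : K ≠ ⊥) :
    1 / 2 ≤ max ‖comm (leftRegular (B 0)) K.starProjection‖
      ‖comm (leftRegular (B 1)) K.starProjection‖ := by
  set n := Module.finrank ℂ K
  set f : Fin n → ell2 G := fun j => (stdOrthonormalBasis ℂ K j : ell2 G)
  have hn0 : (0 : ℝ) < n := by
    have : n ≠ 0 := fun h => hK (Submodule.finrank_eq_zero.1 h)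
    exact_mod_cast Nat.pos_of_ne_zero this
  have hunit : ∀ j, ‖f j‖ = 1 := fun j => (stdOrthonormalBasis ℂ K).orthonormal.1 j
  have key : ∀ i, n - ∑ j, ‖restr (W B (B i)) (f j)‖ ^ 2 - ∑ j, ‖restr (W B (B i)⁻¹) (f j)‖ ^ 2 ≤
      n * ‖comm (leftRegular (B i)) K.starProjection‖ := fun i => by
    have h : ∑ j, ‖restr (W B (B i))ᶜ (f j)‖ ^ 2 - ∑ j, ‖restr (W B (B i)⁻¹) (f j)‖ ^ 2 ≤
        n * ‖comm (leftRegular (B i)) K.starProjection‖ :=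
      sum_norm_sq_restr_sub_le K (B i) (mem_W_inv_iff B i)
    have h2 : ∑ j, ‖restr (W B (B i)) (f j)‖ ^ 2 + ∑ j, ‖restr (W B (B i))ᶜ (f j)‖ ^ 2 = n := by
      rw [← Finset.sum_add_distrib]
      simp only [norm_sq_restr_add_restr_compl, hunit]
      simp
    linarith
  have htot : ∑ j, ‖restr (W B (B 0)) (f j)‖ ^ 2 + ∑ j, ‖restr (W B (B 0)⁻¹) (f j)‖ ^ 2 +
      (∑ j, ‖restr (W B (B 1)) (f j)‖ ^ 2 + ∑ j, ‖restr (W B (B 1)⁻¹) (f j)‖ ^ 2) ≤ n := by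
    rw [← Finset.sum_add_distrib, ← Finset.sum_add_distrib, ← Finset.sum_add_distrib]
    refine (Finset.sum_le_sum (g := fun _ => (1 : ℝ)) fun j _ => ?_).trans (by simp)
    rw [inv_coe_eq_letter, inv_coe_eq_letter, coe_eq_letter, coe_eq_letter]
    rw [norm_sq_restr_union (disjoint_W_letter B (by decide)),
      norm_sq_restr_union (disjoint_W_letter B (by decide)), norm_sq_restr_union]
    · have h := norm_restr_apply_le (W B (letter B (0, true)) ∪ W B (letter B (0, false)) ∪
        (W B (letter B (1, true)) ∪ W B (letter B (1, false)))) (f j)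
      rw [hunit] at h
      exact pow_le_one₀ (norm_nonneg _) h
    · simp only [Set.disjoint_union_left, Set.disjoint_union_right]
      exact ⟨⟨disjoint_W_letter B (by decide), disjoint_W_letter B (by decide)⟩,
        disjoint_W_letter B (by decide), disjoint_W_letter B (by decide)⟩
  have h0 := key 0
  have h1 := key 1
  by_contra! hlt
  obtain ⟨hlt0, hlt1⟩ := max_lt_iff.1 hlt
  have h2 := mul_lt_mul_of_pos_left hlt0 hn0
  have h3 := mul_lt_mul_of_pos_left hlt1 hn0
  linarith

end LowerBound

/-! ### Enlarging almost dominating projections -/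

section Perturbation

variable {H : Type*} [NormedAddCommGroup H] [InnerProductSpace ℂ H]

theorem starProjection_sup {K L : Submodule ℂ H} [K.HasOrthogonalProjection]
    [L.HasOrthogonalProjection] [(K ⊔ L).HasOrthogonalProjection] (h : K ⟂ L) (v : H) :
    (K ⊔ L).starProjection v = K.starProjection v + L.starProjection v := by
  refine (K ⊔ L).eq_starProjection_of_mem_orthogonal ?_ ?_
  · exact Submodule.add_mem_sup (K.starProjection_apply_mem v) (L.starProjection_apply_mem v)
  · rw [← Submodule.inf_orthogonal]
    constructor
    · rw [← sub_sub]
      exact Kᗮ.sub_mem (K.sub_starProjection_mem_orthogonal v)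
        (h.symm.le (L.starProjection_apply_mem v))
    · rw [add_comm, ← sub_sub]
      exact Lᗮ.sub_mem (L.sub_starProjection_mem_orthogonal v)
        (h.le (K.starProjection_apply_mem v))

theorem norm_starProjection_orthogonal_le_norm_sub (K : Submodule ℂ H)
    [K.HasOrthogonalProjection] (v : H) {w : H} (hw : w ∈ K) :
    ‖Kᗮ.starProjection v‖ ≤ ‖v - w‖ := by
  have h : Kᗮ.starProjection v = Kᗮ.starProjection (v - w) := by
    rw [map_sub, (Kᗮ.starProjection_apply_eq_zero_iff).2
      (Submodule.le_orthogonal_orthogonal K hw), sub_zero]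
  rw [h]
  exact Submodule.norm_starProjection_apply_le _ _

/-- If each of the subspaces `K` and `L` is almost contained in the other one, then their
projections are close in norm. -/
theorem norm_starProjection_sub_starProjection_le (K L : Submodule ℂ H)
    [K.HasOrthogonalProjection] [L.HasOrthogonalProjection] {c : ℝ} (hc : 0 ≤ c)
    (hK : ∀ v ∈ K, ‖Lᗮ.starProjection v‖ ≤ c * ‖v‖)
    (hL : ∀ v ∈ L, ‖Kᗮ.starProjection v‖ ≤ c * ‖v‖) :
    ‖K.starProjection - L.starProjection‖ ≤ 2 * c := by
  refine ContinuousLinearMap.opNorm_le_bound _ (by positivity) fun v => ?_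
  have h1 : (K.starProjection - L.starProjection) v =
      Lᗮ.starProjection (K.starProjection v) - L.starProjection (Kᗮ.starProjection v) := by
    have h2 := L.starProjection_add_starProjection_orthogonal (K.starProjection v)
    have h3 := K.starProjection_add_starProjection_orthogonal v
    have h4 : L.starProjection v = L.starProjection (K.starProjection v) +
        L.starProjection (Kᗮ.starProjection v) := by rw [← map_add, h3]
    rw [sub_apply, h4]
    nth_rewrite 1 [← h2]
    abel
  have h5 : ‖L.starProjection (Kᗮ.starProjection v)‖ ≤ c * ‖v‖ := by
    set w := L.starProjection (Kᗮ.starProjection v) with hw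
    have hwL : w ∈ L := L.starProjection_apply_mem _
    have h6 : inner ℂ w w = inner ℂ (Kᗮ.starProjection w) v := by
      rw [Kᗮ.inner_starProjection_left_eq_right]
      nth_rewrite 2 [hw]
      rw [← L.inner_starProjection_left_eq_right, L.starProjection_eq_self_iff.2 hwL]
    have h7 : ‖w‖ * ‖w‖ ≤ c * ‖w‖ * ‖v‖ := by
      calc ‖w‖ * ‖w‖ = ‖inner ℂ w w‖ := by
            rw [inner_self_eq_norm_sq_to_K]; simp [sq]
        _ ≤ ‖Kᗮ.starProjection w‖ * ‖v‖ := by rw [h6]; exact norm_inner_le_norm _ _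
        _ ≤ c * ‖w‖ * ‖v‖ := by gcongr; exact hL w hwL
    rcases (norm_nonneg w).eq_or_lt with h0 | h0
    · rw [← h0]; positivity
    · refine le_of_mul_le_mul_left ?_ h0
      linarith
  have h8 : ‖Lᗮ.starProjection (K.starProjection v)‖ ≤ c * ‖v‖ :=
    (hK _ (K.starProjection_apply_mem v)).trans
      (mul_le_mul_of_nonneg_left (K.norm_starProjection_apply_le v) hc)
  rw [h1]
  refine (norm_sub_le _ _).trans ?_
  linarith

/-- If the projection onto `M` almost dominates the projection onto `K₀`, then a small perturbation
dominates it: replace the image `K'` of `K₀` in `M` by `K₀`, keeping the orthogonal complement of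
`K'` in `M`, which is also orthogonal to `K₀`. -/
theorem exists_starProjection_near (K₀ M : Submodule ℂ H) [FiniteDimensional ℂ K₀]
    [FiniteDimensional ℂ M] {δ : ℝ} (hδ : 0 ≤ δ) (hδ' : δ ≤ 1 / 2)
    (h : ∀ v ∈ K₀, ‖v - M.starProjection v‖ ≤ δ * ‖v‖) :
    ∃ (K : Submodule ℂ H) (_ : FiniteDimensional ℂ K), K₀ ≤ K ∧
      ‖K.starProjection - M.starProjection‖ ≤ 4 * δ := by
  set K' := K₀.map (M.starProjection : H →ₗ[ℂ] H)
  set L := M ⊓ K₀ᗮ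
  have hLfin : FiniteDimensional ℂ L := Submodule.finiteDimensional_of_le (inf_le_left)
  have hL1 : K₀ ⟂ L := by
    rw [Submodule.isOrtho_comm, Submodule.isOrtho_iff_le]
    exact inf_le_right
  have hK'M : K' ≤ M := by
    rintro _ ⟨v, -, rfl⟩
    exact M.starProjection_apply_mem v
  have hin : ∀ l ∈ M, ∀ v, inner ℂ (M.starProjection v) l = inner ℂ v l := fun l hl v => by
    rw [M.inner_starProjection_left_eq_right, M.starProjection_eq_self_iff.2 hl]
  have hL2 : K' ⟂ L := by
    rw [Submodule.isOrtho_iff_inner_eq]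
    rintro _ ⟨v, hv, rfl⟩ l hl
    exact (hin l hl.1 v).trans (Submodule.inner_right_of_mem_orthogonal hv hl.2)
  have hM : M = K' ⊔ L := by
    refine le_antisymm (fun v hv => ?_) (sup_le hK'M inf_le_left)
    rw [← add_sub_cancel (K'.starProjection v) v]
    refine Submodule.add_mem_sup (K'.starProjection_apply_mem v) ?_
    have hmem : v - K'.starProjection v ∈ M := M.sub_mem hv (hK'M (K'.starProjection_apply_mem v))
    refine ⟨hmem, fun k hk => ?_⟩
    rw [← hin _ hmem]
    exact Submodule.inner_right_of_mem_orthogonal (K := K') ⟨k, hk, rfl⟩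
      (K'.sub_starProjection_mem_orthogonal v)
  have hMP : ∀ v, M.starProjection v = K'.starProjection v + L.starProjection v := fun v => by
    have hf : FiniteDimensional ℂ (K' ⊔ L : Submodule ℂ H) := inferInstance
    rw [← starProjection_sup hL2]
    simp only [← hM]
  refine ⟨K₀ ⊔ L, inferInstance, le_sup_left, ?_⟩
  have hdiff : (K₀ ⊔ L).starProjection - M.starProjection =
      K₀.starProjection - K'.starProjection := by
    ext v
    rw [sub_apply, sub_apply, hMP, starProjection_sup hL1]
    abel
  rw [hdiff]
  refine (norm_starProjection_sub_starProjection_le K₀ K' (c := 2 * δ) (by positivity)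
    (fun v hv => ?_) ?_).trans (by linarith)
  · refine (norm_starProjection_orthogonal_le_norm_sub K' v
      (w := M.starProjection v) ⟨v, hv, rfl⟩).trans ((h v hv).trans ?_)
    nlinarith [norm_nonneg v]
  · rintro _ ⟨v, hv, rfl⟩
    refine (norm_starProjection_orthogonal_le_norm_sub K₀ _ hv).trans ?_
    have h1 := h v hv
    have h2 : ‖v‖ ≤ ‖v - M.starProjection v‖ + ‖M.starProjection v‖ := by
      simpa using norm_add_le (v - M.starProjection v) (M.starProjection v)
    have h3 : ‖v‖ ≤ 2 * ‖M.starProjection v‖ := by nlinarith [norm_nonneg v]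
    change ‖M.starProjection v - v‖ ≤ 2 * δ * ‖M.starProjection v‖
    rw [norm_sub_rev]
    nlinarith

/-- Strong convergence to the identity is uniform on finite-dimensional subspaces. -/
theorem eventually_norm_sub_le {ι : Type*} {l : Filter ι} (K : Submodule ℂ H)
    [FiniteDimensional ℂ K] {Q : ι → H →L[ℂ] H} (hQ : ∀ v, Tendsto (fun i => Q i v) l (𝓝 v))
    {δ : ℝ} (hδ : 0 < δ) : ∀ᶠ i in l, ∀ v ∈ K, ‖v - Q i v‖ ≤ δ * ‖v‖ := by
  set e := stdOrthonormalBasis ℂ K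
  have h1 : Tendsto (fun i => ∑ j, ‖(e j : H) - Q i (e j)‖) l (𝓝 0) := by
    have h2 : ∀ j, Tendsto (fun i => ‖(e j : H) - Q i (e j)‖) l (𝓝 0) := fun j => by
      simpa using ((hQ (e j)).const_sub (e j : H)).norm
    simpa using tendsto_finsetSum Finset.univ fun j _ => h2 j
  filter_upwards [h1.eventually_le_const hδ] with i hi v hv
  have h3 : ∑ j, inner ℂ (e j : H) v • (e j : H) = v := by
    have h := congrArg (fun y : K => (y : H)) (e.sum_repr' ⟨v, hv⟩)
    simpa using h
  have h4 : v - Q i v = ∑ j, inner ℂ (e j : H) v • ((e j : H) - Q i (e j)) := by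
    conv_lhs => rw [← h3]
    simp only [map_sum, map_smul, smul_sub, Finset.sum_sub_distrib]
  rw [h4]
  calc ‖∑ j, inner ℂ (e j : H) v • ((e j : H) - Q i (e j))‖
      ≤ ∑ j, ‖v‖ * ‖(e j : H) - Q i (e j)‖ := by
        refine (norm_sum_le _ _).trans (Finset.sum_le_sum fun j _ => ?_)
        rw [norm_smul]
        gcongr
        have h5 := norm_inner_le_norm (𝕜 := ℂ) (e j : H) v
        have h6 : ‖(e j : H)‖ = 1 := e.orthonormal.1 j
        rwa [h6, one_mul] at h5
    _ = (∑ j, ‖(e j : H) - Q i (e j)‖) * ‖v‖ := by rw [← Finset.mul_sum, mul_comm]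
    _ ≤ δ * ‖v‖ := by gcongr

end Perturbation

/-! ### The modulus of quasidiagonality -/

section QD

variable {H : Type*} [NormedAddCommGroup H] [InnerProductSpace ℂ H]

theorem le_iSup_norm_comm {A C : H →L[ℂ] H} (P : H →L[ℂ] H) :
    max ‖comm A P‖ ‖comm C P‖ ≤ ⨆ T : ({A, C} : Set (H →L[ℂ] H)), ‖comm (T : H →L[ℂ] H) P‖ := by
  have hfin : Finite ({A, C} : Set (H →L[ℂ] H)) := Set.toFinite _
  have hb := (Set.finite_range fun T : ({A, C} : Set (H →L[ℂ] H)) =>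
    ‖comm (T : H →L[ℂ] H) P‖).bddAbove
  exact max_le (le_ciSup hb ⟨A, by simp⟩) (le_ciSup hb ⟨C, by simp⟩)

theorem iSup_norm_comm_le {A C : H →L[ℂ] H} {P : H →L[ℂ] H} {c : ℝ} (hA : ‖comm A P‖ ≤ c)
    (hC : ‖comm C P‖ ≤ c) :
    ⨆ T : ({A, C} : Set (H →L[ℂ] H)), ‖comm (T : H →L[ℂ] H) P‖ ≤ c := by
  have hne : Nonempty ({A, C} : Set (H →L[ℂ] H)) := ⟨⟨A, by simp⟩⟩
  refine ciSup_le ?_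
  rintro ⟨T, rfl | rfl⟩
  · exact hA
  · exact hC

variable [CompleteSpace H]

theorem isFiniteRankProjection_starProjection (K : Submodule ℂ H) [FiniteDimensional ℂ K] :
    IsFiniteRankProjection K.starProjection := by
  refine ⟨isStarProjection_starProjection, ?_⟩
  rw [K.range_starProjection]
  infer_instance

theorem IsFiniteRankProjection.exists_eq {P : H →L[ℂ] H} (hP : IsFiniteRankProjection P) :
    ∃ (K : Submodule ℂ H) (_ : FiniteDimensional ℂ K), P = K.starProjection := by
  obtain ⟨h1, h2⟩ := hP
  obtain ⟨_, h3⟩ := isStarProjection_iff_eq_starProjection_range.1 h1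
  exact ⟨_, h2, h3⟩

instance : Nonempty (FiniteRankProjection H) :=
  ⟨⟨_, isFiniteRankProjection_starProjection (⊥ : Submodule ℂ H)⟩⟩

instance : IsDirectedOrder (FiniteRankProjection H) where
  directed := by
    rintro ⟨P₁, h₁⟩ ⟨P₂, h₂⟩
    obtain ⟨K₁, _, rfl⟩ := h₁.exists_eq
    obtain ⟨K₂, _, rfl⟩ := h₂.exists_eq
    exact ⟨⟨_, isFiniteRankProjection_starProjection (K₁ ⊔ K₂)⟩,
      Submodule.starProjection_le_starProjection_iff.2 le_sup_left,
      Submodule.starProjection_le_starProjection_iff.2 le_sup_right⟩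

theorem norm_comm_le_norm_comm_add (T S S' : H →L[ℂ] H) :
    ‖comm T S‖ ≤ ‖comm T S'‖ + 2 * ‖T‖ * ‖S - S'‖ := by
  have h : comm T S = comm T S' + (T * (S - S') - (S - S') * T) := by
    simp only [comm]
    noncomm_ring
  rw [h]
  refine (norm_add_le _ _).trans (add_le_add le_rfl ?_)
  refine (norm_sub_le _ _).trans ?_
  have h1 := norm_mul_le T (S - S')
  have h2 := norm_mul_le (S - S') T
  linarith

theorem norm_comm_le_two_mul (T : H →L[ℂ] H) (P : FiniteRankProjection H) :
    ‖comm T P.1‖ ≤ 2 * ‖T‖ := by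
  obtain ⟨K, _, hK⟩ := P.2.exists_eq
  have h := norm_comm_le_norm_comm_add T P.1 0
  have h1 : ‖P.1 - 0‖ ≤ 1 := by
    rw [sub_zero, hK]
    exact K.starProjection_norm_le
  have h2 : comm T 0 = 0 := by simp [comm]
  rw [h2, norm_zero, zero_add] at h
  nlinarith [norm_nonneg T]

theorem le_qd_pair {A C : H →L[ℂ] H} {c : ℝ} {P₀ : FiniteRankProjection H}
    (h : ∀ P ≥ P₀, c ≤ max ‖comm A P.1‖ ‖comm C P.1‖) : c ≤ qd {A, C} := by
  refine le_liminf_of_le ?_ ?_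
  · refine isCoboundedUnder_ge_of_le atTop (x := max (2 * ‖A‖) (2 * ‖C‖)) fun P => ?_
    exact iSup_norm_comm_le ((norm_comm_le_two_mul A P).trans (le_max_left _ _))
      ((norm_comm_le_two_mul C P).trans (le_max_right _ _))
  · filter_upwards [eventually_ge_atTop P₀] with P hP
    exact (h P hP).trans (le_iSup_norm_comm P.1)

/-- Finite rank projections that converge strongly to the identity need not eventually dominate a
given finite rank projection, but small perturbations of them do, so that their commutators bound
the modulus from above. -/
theorem qd_pair_le_of_tendsto {A C : H →L[ℂ] H} {c : ℝ} {ι : Type*} {l : Filter ι} [l.NeBot]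
    {Q : ι → H →L[ℂ] H} (hQ : ∀ i, IsFiniteRankProjection (Q i))
    (hlim : ∀ v, Tendsto (fun i => Q i v) l (𝓝 v))
    (hc : ∀ ε > 0, ∀ᶠ i in l, ‖comm A (Q i)‖ ≤ c + ε ∧ ‖comm C (Q i)‖ ≤ c + ε) :
    qd {A, C} ≤ c := by
  refine le_of_forall_pos_le_add fun ε hε => ?_
  refine liminf_le_of_frequently_le ?_ ?_
  · rw [frequently_atTop]
    intro P₀
    obtain ⟨K₀, _, hK₀⟩ := P₀.2.exists_eq
    set t := ‖A‖ + ‖C‖ + 1 with ht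
    have htpos : 0 < t := by positivity
    set δ := min (1 / 2) (ε / (16 * t))
    have hδ0 : 0 < δ := by positivity
    obtain ⟨i, hi, hiA, hiC⟩ := ((eventually_norm_sub_le K₀ hlim hδ0).and
      (hc (ε / 2) (by positivity))).exists
    obtain ⟨M, _, hM⟩ := (hQ i).exists_eq
    rw [hM] at hi hiA hiC
    obtain ⟨K, _, hle, hK⟩ := exists_starProjection_near K₀ M hδ0.le (min_le_left _ _) hi
    have hδε : t * δ ≤ ε / 16 := by
      have h1 : δ ≤ ε / (16 * t) := min_le_right _ _
      rw [le_div_iff₀ (by positivity)] at h1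
      linarith
    refine ⟨⟨_, isFiniteRankProjection_starProjection K⟩, ?_, ?_⟩
    · change P₀.1 ≤ K.starProjection
      rw [hK₀]
      exact Submodule.starProjection_le_starProjection_iff.2 hle
    · have key : ∀ T : H →L[ℂ] H, ‖T‖ ≤ t → ‖comm T M.starProjection‖ ≤ c + ε / 2 →
          ‖comm T K.starProjection‖ ≤ c + ε := by
        intro T hT hTM
        have h1 := norm_comm_le_norm_comm_add T K.starProjection M.starProjection
        have h2 : ‖T‖ * ‖K.starProjection - M.starProjection‖ ≤ t * (4 * δ) :=
          mul_le_mul hT hK (norm_nonneg _) htpos.le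
        linarith
      exact iSup_norm_comm_le (key A (by linarith [norm_nonneg C]) hiA)
        (key C (by linarith [norm_nonneg A]) hiC)
  · exact isBoundedUnder_of ⟨0, fun P => Real.iSup_nonneg fun T => norm_nonneg _⟩

end QD

section Main

variable {G : Type*} [Group G] (B : FreeGroupBasis (Fin 2) G)

theorem half_le_qd : 1 / 2 ≤ qd {leftRegular (B 0), leftRegular (B 1)} := by
  refine le_qd_pair
    (P₀ := ⟨_, isFiniteRankProjection_starProjection (Submodule.span ℂ {delta (1 : G)})⟩) ?_
  rintro ⟨P, hP⟩ hle
  obtain ⟨K, _, rfl⟩ := hP.exists_eq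
  refine half_le_max_norm_comm B K ?_
  rintro rfl
  have hle' : Submodule.span ℂ {delta (1 : G)} ≤ ⊥ :=
    Submodule.starProjection_le_starProjection_iff.1 hle
  have h0 : delta (1 : G) = 0 := by simpa using hle'
  have h1 := norm_delta (1 : G)
  rw [h0, norm_zero] at h1
  exact zero_ne_one h1

/-- The commutator estimate is applied with `R = ⌊√N⌋`, for which `R → ∞` and `R / N → 0`. -/
theorem qd_le : qd {leftRegular (B 0), leftRegular (B 1)} ≤ Real.sqrt 3 / 2 := by
  have hR : Tendsto Nat.sqrt atTop atTop := by
    refine tendsto_atTop.2 fun b => ?_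
    filter_upwards [eventually_ge_atTop (b * b)] with N hN
    exact Nat.le_sqrt.2 hN
  refine qd_pair_le_of_tendsto (l := atTop) (Q := fun N => Q B N (Nat.sqrt N))
    (fun N => isFiniteRankProjection_Q B _ _) (tendsto_Q B hR) fun ε hε => ?_
  have hlim : Tendsto (fun N : ℕ => 2 * Real.sqrt (2 / (Nat.sqrt N : ℕ))) atTop (𝓝 0) := by
    have h := ((tendsto_const_div_atTop_nhds_zero_nat (2 : ℝ)).sqrt.const_mul 2).comp hR
    rwa [Real.sqrt_zero, mul_zero] at h
  filter_upwards [hlim.eventually_le_const hε, hR.eventually_ge_atTop 3] with N hN hN3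
  have hsq : Nat.sqrt N * Nat.sqrt N ≤ N := Nat.sqrt_le N
  have hsq' : (Nat.sqrt N : ℝ) * Nat.sqrt N ≤ N := by exact_mod_cast hsq
  have hpos : (3 : ℝ) ≤ Nat.sqrt N := by exact_mod_cast hN3
  have hlt : 2 * Nat.sqrt N < N := by nlinarith
  have hNpos : (0 : ℝ) < N := by nlinarith
  have h1 : Real.sqrt (2 / N) ≤ Real.sqrt (2 / (Nat.sqrt N : ℕ)) := by
    apply Real.sqrt_le_sqrt
    gcongr
    nlinarith
  have h2 : Real.sqrt (2 * (Nat.sqrt N : ℕ) / N) ≤ Real.sqrt (2 / (Nat.sqrt N : ℕ)) := by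
    apply Real.sqrt_le_sqrt
    rw [div_le_div_iff₀ hNpos (by linarith)]
    linarith
  have key : ∀ i, ‖comm (leftRegular (B i)) (Q B N (Nat.sqrt N))‖ ≤ Real.sqrt 3 / 2 + ε :=
    fun i => (norm_comm_leftRegular_Q_le B hlt i).trans (by linarith)
  exact ⟨key 0, key 1⟩

end Main

end

end FreeQD

theorem theorem2p5 {G : Type*} [Group G] (B : FreeGroupBasis (Fin 2) G) :
    (∀ N R : ℕ, FreeQD.IsFiniteRankProjection (FreeQD.Q B N R)) ∧
    (∃ N₀ : ℕ, ∀ N R : ℕ, N₀ ≤ N → 1 ≤ R → (R : ℝ) * 4 ^ R ≤ (N : ℝ) ^ (1 / 4 : ℝ) →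
      max ‖FreeQD.comm (FreeQD.leftRegular (B 0)) (FreeQD.Q B N R)‖
          ‖FreeQD.comm (FreeQD.leftRegular (B 1)) (FreeQD.Q B N R)‖
        ≤ Real.sqrt 3 / 2 + (N : ℝ) ^ (-(1 / 9) : ℝ)) ∧
    (∀ R : ℕ → ℕ, Filter.Tendsto R Filter.atTop Filter.atTop → ∀ ξ : FreeQD.ell2 G,
      Filter.Tendsto (fun N => FreeQD.Q B N (R N) ξ) Filter.atTop (nhds ξ)) ∧
    FreeQD.qd {FreeQD.leftRegular (B 0), FreeQD.leftRegular (B 1)} ∈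
      Set.Icc (1 / 2 : ℝ) (Real.sqrt 3 / 2) := by
  refine ⟨FreeQD.isFiniteRankProjection_Q B, ⟨4, fun N R hN hR h => ?_⟩,
    fun R hR => FreeQD.tendsto_Q B hR, FreeQD.half_le_qd B, FreeQD.qd_le B⟩
  obtain ⟨h1, h2⟩ := FreeQD.error_le hN hR h
  exact max_le ((FreeQD.norm_comm_leftRegular_Q_le B h1 0).trans (by linarith))
    ((FreeQD.norm_comm_leftRegular_Q_le B h1 1).trans (by linarith))
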